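/- **Setting.** $n$ threads run an arbitrary, arbitrarily interleaved program under sequential consistency; a *step* of a thread is at most one atomic access to shared memory (load, store, wait-free F&A, WCAS on a pair of adjacent words, or a load/store of such a pair) followed by local instructions. Any thread may be arbitrarily slow or stop. Eras, tags and counters do not overflow. Besides arbitrary operations on its own memory, whose references never hold the reserved value $\mathtt{invptr}$, the application calls the operations of the *Wait-Free Eras* (WFE) scheme. Initially `global_era` $=1$, `counter_start` $=$ `counter_end` $=0$, every reservation `resv[i][s]` is the pair (era $A$, tag $B$) $=(\infty,0)$ ($s<h+2$, where $s<h$ are the normal and $h$, $h+1$ the special reservations), and every request record `state[i][j]` ($j<h$) has `result` $=(\mathtt{nullptr},\infty)$. * `get_protected(ptr, j, parent)` by thread $t$: set `prevEra = resv[t][j].A`. *Fast path*, at most $M\ge 1$ times: `ret = *ptr; newEra = global_era`; if `prevEra == newEra`, return `ret`; otherwise `resv[t][j].A = newEra; prevEra = newEra`. *Slow path*: read `alloc_era` from the parent ($\infty$ if there is none); F&A(`counter_start`, 1); `state[t][j].pointer = ptr`; `state[t][j].era = alloc_era`; `tag = resv[t][j].B`; `state[t][j].result = (invptr, tag)`.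 Then repeat: `ret = *ptr; newEra = global_era`; if `prevEra == newEra` and WCAS(`state[t][j].result`, `(invptr, tag)`, `(nullptr, ∞)`) succeeds, then set `resv[t][j].B = tag + 1`, F&A(`counter_end`, 1), return `ret`; otherwise WCAS(`resv[t][j]`, `(prevEra, tag)`, `(newEra, tag)`), `prevEra = newEra`, `resPtr = state[t][j].result.A`, `resEra = state[t][j].result.B`; while `resPtr == invptr`. Finally `resv[t][j].A = resEra`, `resv[t][j].B = tag + 1`, F&A(`counter_end`, 1), return `resPtr`. * `increment_era()`: `ce = counter_end; cs = counter_start`; if `cs != ce`, then for all $i<n$, $j<h$ with `state[i][j].result.A == invptr` run `help_thread(i, j)`; finally F&A(`global_era`, 1). * `help_thread(i, j)` by thread $t$: read `result = state[i][j].result` and return if `result.A != invptr`; `resv[t][h].A = state[i][j].era`; `ptr = state[i][j].pointer`; `tag = resv[i][j].B`. If `tag == result.B`: `prevEra = global_era`, and repeat: `resv[t][h+1].A = prevEra; ret = *ptr; newEra = global_era`; if `prevEra == newEra`, then try WCAS(`state[i][j].result`, `(invptr, tag)`, `(ret, newEra)`), on success repeat WCAS(`resv[i][j]`, `old`, `(newEra,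 tag + 1)`) with freshly read `old` until it succeeds or `old.B != tag`, and in any case leave the loop; otherwise `prevEra = newEra`; while `state[i][j].result == (invptr, tag)`; then `resv[t][h+1].A = ∞`. At the end `resv[t][h].A = ∞`. * `alloc_block()` periodically calls `increment_era()`, obtains a free block and stores the current global era as its `alloc_era`. `retire(blk)` stores the current global era as `retire_era` and appends `blk` to the thread's retire list; periodically it calls `increment_era()`, if the global era still equals that `retire_era`, and then `cleanup()`, which scans the reservations and frees the retired blocks whose lifespan contains no reserved era. `clear()` resets the normal reservations of the calling thread to $\infty$. **Theorem (`get_protected()` is wait-free bounded).** In every execution, every call of `get_protected()` by a thread $t$ has the following properties, whatever the other threads do. 1. As long as the call has not returned, $t$ can make a next step. 2. The fast path makes at most $M$ attempts. 3. At most $n$ iterations of the slow-path loop are unsuccessful, i.e. end with `resPtr == invptr` and cause the loop to be repeated; in every other iteration the global era has stayed stable and the request is cancelled, or the result has been produced by a helper. 4. There is an absolute constant $C$ (independent of $n$, $M$, $h$, the application and the execution) such that the call takes at most $C\,(M+n)$ steps of $t$; once $t$ has made more than that many steps after the invocation, the call has returned. -/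

import Mathlib

/-!
# The Wait-Free Eras (WFE) memory reclamation scheme as a sequentially consistent transition system

`n` threads share the global era, the slow-path counters, the reservations, the slow-path requests
(`state`), and the memory of the application.  The machine is an interleaving machine: one step of
one thread makes at most one atomic access (load, store, F&A, WCAS, wide load or wide store) to the
shared memory and then runs local instructions up to the next shared access.  Eras, tags and
counters are unbounded natural numbers (64-bit words that do not overflow), and `⊤ : ℕ∞` is the era
value `∞`.
-/

namespace WFE

/-- The static parameters of the scheme. -/
structure Params where
  /-- the number of threads -/
  n : ℕ
  /-- the number of reservations per thread that the application may use -/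
  maxHes : ℕ
  /-- the number of attempts made on the fast path of `get_protected()` -/
  maxAttempts : ℕ
  /-- every `eraFreq`-th `alloc_block()` increments the era -/
  eraFreq : ℕ
  /-- every `cleanupFreq`-th `retire()` runs `cleanup()` -/
  cleanupFreq : ℕ
  maxAttempts_pos : 0 < maxAttempts
  eraFreq_pos : 0 < eraFreq
  cleanupFreq_pos : 0 < cleanupFreq

/-- A pointer word: the reserved value `invptr`, or a pointer that an application may store
(`val none` is `nullptr`). -/
inductive Ptr (Blk : Type) where
  | invptr
  | val (p : Option Blk)
  deriving DecidableEq

/-- The slow-path request record of one reservation.  `result` is `(invptr, tag)` while the request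
of the slow-path cycle `tag` is pending, and `(pointer, era)` otherwise. -/
structure Request (Blk Loc : Type) where
  result : Ptr Blk × ℕ∞
  /-- `alloc_era` of the parent block (`∞` if there is no parent) -/
  era : ℕ∞
  /-- the location of the hazardous reference -/
  pointer : Loc

/-- The arguments of a call `get_protected(ptr, index, parent)`. -/
structure Args (P : Params) (Blk Loc : Type) where
  ptr : Loc
  index : Fin P.maxHes
  parent : Option Blk

/-- The shared memory. -/
structure Shared (P : Params) (Blk Loc : Type) where
  globalEra : ℕ
  counterStart : ℕ
  counterEnd : ℕ
  /-- The pairs (era, tag).  Each thread has `maxHes` normal reservations and two special ones. -/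
  resv : Fin P.n → Fin (P.maxHes + 2) → ℕ∞ × ℕ
  state : Fin P.n → Fin P.maxHes → Request Blk Loc
  /-- The application's hazardous references.  They never hold `invptr`. -/
  heap : Loc → Option Blk
  allocEra : Blk → ℕ
  retireEra : Blk → ℕ
  /-- the currently allocated blocks -/
  live : Set Blk

/-- The lines of `get_protected()`, with the values of the local variables that are still used. -/
inductive GPLine (Blk : Type) where
  /-- `prevEra = reservations[tid][index].A` -/
  | start
  /-- fast path: `ret = *ptr` -/
  | fastDeref (attempts : ℕ) (prevEra : ℕ∞)
  /-- fast path: `newEra = global_era; if (prevEra == newEra) return ret` -/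
  | fastCheck (attempts : ℕ) (prevEra : ℕ∞) (ret : Option Blk)
  /-- fast path: `reservations[tid][index].A = newEra; prevEra = newEra; while (--attempts != 0)` -/
  | fastPublish (attempts : ℕ) (newEra : ℕ)
  /-- `alloc_era = (parent == nullptr) ? ∞ : parent->alloc_era` -/
  | parentEra (prevEra : ℕ∞)
  /-- `F&A(&counter_start, 1)` -/
  | enter (prevEra allocEra : ℕ∞)
  /-- `state[tid][index].pointer = ptr` -/
  | setPointer (prevEra allocEra : ℕ∞)
  /-- `state[tid][index].era = alloc_era` -/
  | setEra (prevEra allocEra : ℕ∞)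
  /-- `tag = reservations[tid][index].B` -/
  | readTag (prevEra : ℕ∞)
  /-- `state[tid][index].result = { invptr, tag }` -/
  | request (tag : ℕ) (prevEra : ℕ∞)
  /-- first line of the slow-path loop: `ret = *ptr` -/
  | loopDeref (tag : ℕ) (prevEra : ℕ∞)
  /-- `newEra = global_era; if (prevEra == newEra && ...)` -/
  | loopCheck (tag : ℕ) (prevEra : ℕ∞) (ret : Option Blk)
  /-- `WCAS(&state[tid][index].result, { invptr, tag }, { nullptr, ∞ })` -/
  | cancel (tag : ℕ) (prevEra : ℕ∞) (newEra : ℕ) (ret : Option Blk)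
  /-- after a successful cancellation: `reservations[tid][index].B = tag + 1` -/
  | cancelTag (tag : ℕ) (ret : Option Blk)
  /-- after a successful cancellation: `F&A(&counter_end, 1); return ret` -/
  | cancelLeave (ret : Option Blk)
  /-- `WCAS(&reservations[tid][index], { prevEra, tag }, { newEra, tag }); prevEra = newEra` -/
  | loopPublish (tag : ℕ) (prevEra : ℕ∞) (newEra : ℕ)
  /-- `resPtr = state[tid][index].result.A` -/
  | loopResPtr (tag : ℕ) (prevEra : ℕ∞)
  /-- last line of the slow-path loop:
  `resEra = state[tid][index].result.B; while (resPtr == invptr)` -/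
  | loopTest (tag : ℕ) (prevEra : ℕ∞) (resPtr : Ptr Blk)
  /-- `reservations[tid][index].A = resEra` -/
  | finishEra (tag : ℕ) (resPtr : Option Blk) (resEra : ℕ∞)
  /-- `reservations[tid][index].B = tag + 1` -/
  | finishTag (tag : ℕ) (resPtr : Option Blk)
  /-- `F&A(&counter_end, 1); return resPtr` -/
  | finishLeave (resPtr : Option Blk)

/-- The lines of `increment_era()`. -/
inductive IncLine (P : Params) where
  /-- `ce = counter_end` -/
  | readEnd
  /-- `cs = counter_start; if (cs != ce)` -/
  | readStart (ce : ℕ)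
  /-- the loop over all pairs `(i, j)`, of which `todo` is left:
  `if (state[i][j].result.A == invptr) help_thread(i, j)` -/
  | scan (todo : List (Fin P.n × Fin P.maxHes))
  /-- `F&A(&global_era, 1)` -/
  | bump

/-- The lines of `help_thread(i, j)`. -/
inductive HelpLine (Blk Loc : Type) where
  /-- `result = state[i][j].result; if (result.A != invptr) return` -/
  | readResult
  /-- `era = state[i][j].era` -/
  | readEra (reqTag : ℕ∞)
  /-- `reservations[mytid][max_hes].A = era` -/
  | reserveParent (reqTag : ℕ∞) (era : ℕ∞)
  /-- `ptr = state[i][j].pointer` -/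
  | readPointer (reqTag : ℕ∞)
  /-- `tag = reservations[i][j].B; if (tag != result.B)` give up -/
  | checkTag (reqTag : ℕ∞) (ptr : Loc)
  /-- `prevEra = global_era` -/
  | firstEra (tag : ℕ) (ptr : Loc)
  /-- first line of the loop: `reservations[mytid][max_hes+1].A = prevEra` -/
  | reserve (tag : ℕ) (ptr : Loc) (prevEra : ℕ)
  /-- `ret = *ptr` -/
  | deref (tag : ℕ) (ptr : Loc) (prevEra : ℕ)
  /-- `newEra = global_era; if (prevEra == newEra)` -/
  | checkEra (tag : ℕ) (ptr : Loc) (prevEra : ℕ) (ret : Option Blk)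
  /-- `WCAS(&state[i][j].result, { invptr, tag }, { ret, newEra })` -/
  | deliver (tag : ℕ) (newEra : ℕ) (ret : Option Blk)
  /-- `old = reservations[i][j]; if (old.B != tag) break` -/
  | handRead (tag : ℕ) (newEra : ℕ)
  /-- `WCAS(&reservations[i][j], old, { newEra, tag + 1 })`, repeated until it succeeds -/
  | handSwap (tag : ℕ) (newEra : ℕ) (old : ℕ∞ × ℕ)
  /-- last line of the loop: `while (state[i][j].result == { invptr, tag })` -/
  | loopTest (tag : ℕ) (ptr : Loc) (prevEra : ℕ)
  /-- `reservations[mytid][max_hes+1].A = ∞` -/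
  | release
  /-- `reservations[mytid][max_hes].A = ∞` -/
  | releaseParent

/-- The lines of `alloc_block()`. -/
inductive AllocLine (Blk : Type) where
  /-- `if (alloc_counter++ % era_freq == 0) increment_era()` -/
  | start
  /-- `blk = malloc()` -/
  | malloc
  /-- `era = global_era` -/
  | readEra (blk : Blk)
  /-- `blk->alloc_era = era; return blk` -/
  | setEra (blk : Blk) (era : ℕ)

/-- The lines of `retire()`. -/
inductive RetireLine (Blk : Type) where
  /-- `era = global_era` -/
  | readEra (blk : Blk)
  /-- `blk->retire_era = era; retire_list.append(blk);
  if (retire_counter++ % cleanup_freq == 0)` -/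
  | setEra (blk : Blk) (era : ℕ)
  /-- `if (blk->retire_era == global_era) increment_era()`, then `cleanup()` -/
  | checkEra (era : ℕ)

/-- The lines of `cleanup()`.  `kept` are the blocks already found to be in use, `rest` the blocks
still to be examined. -/
inductive CleanupLine (P : Params) (Blk : Type) where
  /-- next block; `ce = counter_end` -/
  | next (kept rest : List Blk)
  /-- first scan of the normal reservations, of which `todo` is left -/
  | scan (kept rest : List Blk) (blk : Blk) (ce : ℕ)
      (todo : List (Fin P.n × Fin (P.maxHes + 2)))
  /-- `if (ce == counter_start)` the block is freed, otherwise scan again -/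
  | readStart (kept rest : List Blk) (blk : Blk) (ce : ℕ)
  /-- scan of the special and, once more, of the normal reservations, of which `todo` is left -/
  | rescan (kept rest : List Blk) (blk : Blk) (todo : List (Fin P.n × Fin (P.maxHes + 2)))

/-- The operation that called `increment_era()`. -/
inductive Caller where
  | alloc
  | retire

/-- The program counter of a thread; `app` means that it runs application code. -/
inductive PC (P : Params) (Blk Loc : Type) where
  | app
  | getProtected (a : Args P Blk Loc) (l : GPLine Blk)
  | incrementEra (k : Caller) (l : IncLine P)
  /-- `help_thread(i, j)`, called from the loop of `increment_era()` -/
  | help (k : Caller) (i : Fin P.n) (j : Fin P.maxHes) (rest : List (Fin P.n × Fin P.maxHes))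
      (l : HelpLine Blk Loc)
  | alloc (l : AllocLine Blk)
  | retire (l : RetireLine Blk)
  | cleanup (l : CleanupLine P Blk)
  /-- `clear()`: the reservations still to be reset -/
  | clear (todo : List (Fin P.maxHes))

/-- The private memory of a thread. -/
structure Local (P : Params) (Blk Loc : Type) where
  pc : PC P Blk Loc
  allocCounter : ℕ
  retireCounter : ℕ
  retireList : List Blk
  /-- the pointer returned by the last `get_protected()` or `alloc_block()` -/
  ret : Option Blk

structure Config (P : Params) (Blk Loc : Type) where
  shared : Shared P Blk Loc
  thread : Fin P.n → Local P Blk Loc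

section Code

variable {P : Params} {Blk Loc : Type}

/-- The normal reservation with a given index. -/
def normal (j : Fin P.maxHes) : Fin (P.maxHes + 2) := Fin.castAdd 2 j

/-- The special reservation of `help_thread()` for the parent block. -/
def special₁ : Fin (P.maxHes + 2) := Fin.natAdd P.maxHes 0

/-- The special reservation of `help_thread()` for the block that is retrieved. -/
def special₂ : Fin (P.maxHes + 2) := Fin.natAdd P.maxHes 1

def Shared.setResv (S : Shared P Blk Loc) (i : Fin P.n) (s : Fin (P.maxHes + 2)) (v : ℕ∞ × ℕ) :
    Shared P Blk Loc :=
  { S with resv := Function.update S.resv i (Function.update (S.resv i) s v) }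

/-- `reservations[i][s].A = era` -/
def Shared.setResvEra (S : Shared P Blk Loc) (i : Fin P.n) (s : Fin (P.maxHes + 2)) (era : ℕ∞) :
    Shared P Blk Loc :=
  S.setResv i s (era, (S.resv i s).2)

/-- `reservations[i][s].B = tag` -/
def Shared.setResvTag (S : Shared P Blk Loc) (i : Fin P.n) (s : Fin (P.maxHes + 2)) (tag : ℕ) :
    Shared P Blk Loc :=
  S.setResv i s ((S.resv i s).1, tag)

def Shared.setRequest (S : Shared P Blk Loc) (i : Fin P.n) (j : Fin P.maxHes)
    (q : Request Blk Loc) : Shared P Blk Loc :=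
  { S with state := Function.update S.state i (Function.update (S.state i) j q) }

/-- `state[i][j].result = r` -/
def Shared.setResult (S : Shared P Blk Loc) (i : Fin P.n) (j : Fin P.maxHes)
    (r : Ptr Blk × ℕ∞) : Shared P Blk Loc :=
  S.setRequest i j { S.state i j with result := r }

def Local.goto (L : Local P Blk Loc) (pc : PC P Blk Loc) : Local P Blk Loc :=
  { L with pc := pc }

/-- Return to the application with a pointer. -/
def Local.done (L : Local P Blk Loc) (ret : Option Blk) : Local P Blk Loc :=
  { L with pc := .app, ret := ret }

/-- One step of thread `t` inside `get_protected()`. -/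
def gpStep [DecidableEq Blk] (t : Fin P.n) (a : Args P Blk Loc) (l : GPLine Blk)
    (S : Shared P Blk Loc) (L : Local P Blk Loc) : Shared P Blk Loc × Local P Blk Loc :=
  let go (l' : GPLine Blk) : Local P Blk Loc := L.goto (.getProtected a l')
  match l with
  | .start => (S, go (.fastDeref P.maxAttempts (S.resv t (normal a.index)).1))
  | .fastDeref attempts prevEra => (S, go (.fastCheck attempts prevEra (S.heap a.ptr)))
  | .fastCheck attempts prevEra ret =>
      if prevEra = (S.globalEra : ℕ∞) then (S, L.done ret)
      else (S, go (.fastPublish attempts S.globalEra))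
  | .fastPublish attempts newEra =>
      (S.setResvEra t (normal a.index) newEra,
        if attempts - 1 ≠ 0 then go (.fastDeref (attempts - 1) newEra)
        else go (.parentEra newEra))
  | .parentEra prevEra =>
      (S, go (.enter prevEra (match a.parent with
        | none => ⊤
        | some b => (S.allocEra b : ℕ∞))))
  | .enter prevEra allocEra =>
      ({ S with counterStart := S.counterStart + 1 }, go (.setPointer prevEra allocEra))
  | .setPointer prevEra allocEra =>
      (S.setRequest t a.index { S.state t a.index with pointer := a.ptr },
        go (.setEra prevEra allocEra))
  | .setEra prevEra allocEra =>
      (S.setRequest t a.index { S.state t a.index with era := allocEra }, go (.readTag prevEra))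
  | .readTag prevEra => (S, go (.request (S.resv t (normal a.index)).2 prevEra))
  | .request tag prevEra =>
      (S.setResult t a.index (.invptr, (tag : ℕ∞)), go (.loopDeref tag prevEra))
  | .loopDeref tag prevEra => (S, go (.loopCheck tag prevEra (S.heap a.ptr)))
  | .loopCheck tag prevEra ret =>
      if prevEra = (S.globalEra : ℕ∞) then (S, go (.cancel tag prevEra S.globalEra ret))
      else (S, go (.loopPublish tag prevEra S.globalEra))
  | .cancel tag prevEra newEra ret =>
      if (S.state t a.index).result = (.invptr, (tag : ℕ∞)) then
        (S.setResult t a.index (.val none, ⊤), go (.cancelTag tag ret))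
      else (S, go (.loopPublish tag prevEra newEra))
  | .cancelTag tag ret => (S.setResvTag t (normal a.index) (tag + 1), go (.cancelLeave ret))
  | .cancelLeave ret => ({ S with counterEnd := S.counterEnd + 1 }, L.done ret)
  | .loopPublish tag prevEra newEra =>
      (if S.resv t (normal a.index) = (prevEra, tag) then
          S.setResv t (normal a.index) ((newEra : ℕ∞), tag)
        else S,
        go (.loopResPtr tag newEra))
  | .loopResPtr tag prevEra => (S, go (.loopTest tag prevEra (S.state t a.index).result.1))
  | .loopTest tag prevEra resPtr =>
      match resPtr with
      | .invptr => (S, go (.loopDeref tag prevEra))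
      | .val p => (S, go (.finishEra tag p (S.state t a.index).result.2))
  | .finishEra tag resPtr resEra =>
      (S.setResvEra t (normal a.index) resEra, go (.finishTag tag resPtr))
  | .finishTag tag resPtr => (S.setResvTag t (normal a.index) (tag + 1), go (.finishLeave resPtr))
  | .finishLeave resPtr => ({ S with counterEnd := S.counterEnd + 1 }, L.done resPtr)

/-- All pairs `(i, j)` of a thread and a normal index, in the order of the nested loops. -/
def allSlots : List (Fin P.n × Fin P.maxHes) :=
  List.finRange P.n ×ˢ List.finRange P.maxHes

/-- One step inside `increment_era()`. -/
def incStep (k : Caller) (l : IncLine P) (S : Shared P Blk Loc) (L : Local P Blk Loc) :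
    Shared P Blk Loc × Local P Blk Loc :=
  match l with
  | .readEnd => (S, L.goto (.incrementEra k (.readStart S.counterEnd)))
  | .readStart ce =>
      (S, L.goto (.incrementEra k (if S.counterStart ≠ ce then .scan allSlots else .bump)))
  | .scan [] => (S, L.goto (.incrementEra k .bump))
  | .scan ((i, j) :: rest) =>
      match (S.state i j).result.1 with
      | .invptr => (S, L.goto (.help k i j rest .readResult))
      | .val _ => (S, L.goto (.incrementEra k (.scan rest)))
  | .bump =>
      ({ S with globalEra := S.globalEra + 1 },
        match k with
        | .alloc => L.goto (.alloc .malloc)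
        | .retire => L.goto (.cleanup (.next [] L.retireList)))

/-- One step of thread `t` inside `help_thread(i, j)`. -/
def helpStep [DecidableEq Blk] (t : Fin P.n) (k : Caller) (i : Fin P.n) (j : Fin P.maxHes)
    (rest : List (Fin P.n × Fin P.maxHes)) (l : HelpLine Blk Loc)
    (S : Shared P Blk Loc) (L : Local P Blk Loc) : Shared P Blk Loc × Local P Blk Loc :=
  let go (l' : HelpLine Blk Loc) : Local P Blk Loc := L.goto (.help k i j rest l')
  let leave : Local P Blk Loc := L.goto (.incrementEra k (.scan rest))
  match l with
  | .readResult =>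
      match (S.state i j).result with
      | (.invptr, reqTag) => (S, go (.readEra reqTag))
      | (.val _, _) => (S, leave)
  | .readEra reqTag => (S, go (.reserveParent reqTag (S.state i j).era))
  | .reserveParent reqTag era => (S.setResvEra t special₁ era, go (.readPointer reqTag))
  | .readPointer reqTag => (S, go (.checkTag reqTag (S.state i j).pointer))
  | .checkTag reqTag ptr =>
      if ((S.resv i (normal j)).2 : ℕ∞) = reqTag then
        (S, go (.firstEra (S.resv i (normal j)).2 ptr))
      else (S, go .releaseParent)
  | .firstEra tag ptr => (S, go (.reserve tag ptr S.globalEra))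
  | .reserve tag ptr prevEra => (S.setResvEra t special₂ prevEra, go (.deref tag ptr prevEra))
  | .deref tag ptr prevEra => (S, go (.checkEra tag ptr prevEra (S.heap ptr)))
  | .checkEra tag ptr prevEra ret =>
      if prevEra = S.globalEra then (S, go (.deliver tag S.globalEra ret))
      else (S, go (.loopTest tag ptr S.globalEra))
  | .deliver tag newEra ret =>
      if (S.state i j).result = (.invptr, (tag : ℕ∞)) then
        (S.setResult i j (.val ret, (newEra : ℕ∞)), go (.handRead tag newEra))
      else (S, go .release)
  | .handRead tag newEra =>
      if (S.resv i (normal j)).2 = tag then (S, go (.handSwap tag newEra (S.resv i (normal j))))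
      else (S, go .release)
  | .handSwap tag newEra old =>
      if S.resv i (normal j) = old then
        (S.setResv i (normal j) ((newEra : ℕ∞), tag + 1), go .release)
      else (S, go (.handRead tag newEra))
  | .loopTest tag ptr prevEra =>
      if (S.state i j).result = (.invptr, (tag : ℕ∞)) then (S, go (.reserve tag ptr prevEra))
      else (S, go .release)
  | .release => (S.setResvEra t special₂ ⊤, go .releaseParent)
  | .releaseParent => (S.setResvEra t special₁ ⊤, leave)

/-- One step inside `alloc_block()`, other than `malloc()`. -/
def allocStep [DecidableEq Blk] (l : AllocLine Blk) (S : Shared P Blk Loc)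
    (L : Local P Blk Loc) : Shared P Blk Loc × Local P Blk Loc :=
  match l with
  | .start =>
      (S, { L with
        allocCounter := L.allocCounter + 1
        pc := if L.allocCounter % P.eraFreq = 0 then .incrementEra .alloc .readEnd
              else .alloc .malloc })
  | .malloc => (S, L)
  | .readEra blk => (S, L.goto (.alloc (.setEra blk S.globalEra)))
  | .setEra blk era => ({ S with allocEra := Function.update S.allocEra blk era }, L.done (some blk))

/-- One step inside `retire()`. -/
def retireStep [DecidableEq Blk] (l : RetireLine Blk) (S : Shared P Blk Loc)
    (L : Local P Blk Loc) : Shared P Blk Loc × Local P Blk Loc :=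
  match l with
  | .readEra blk => (S, L.goto (.retire (.setEra blk S.globalEra)))
  | .setEra blk era =>
      ({ S with retireEra := Function.update S.retireEra blk era },
        { L with
          retireList := L.retireList ++ [blk]
          retireCounter := L.retireCounter + 1
          pc := if L.retireCounter % P.cleanupFreq = 0 then .retire (.checkEra era) else .app })
  | .checkEra era =>
      (S, L.goto (if era = S.globalEra then .incrementEra .retire .readEnd
                  else .cleanup (.next [] L.retireList)))

/-- The normal reservations of all threads. -/
def normalSlots : List (Fin P.n × Fin (P.maxHes + 2)) :=
  List.finRange P.n ×ˢ (List.finRange P.maxHes).map normal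

/-- The second scan of `cleanup()`: the first special reservation of all threads, then the second
one, then once more the normal reservations. -/
def rescanSlots : List (Fin P.n × Fin (P.maxHes + 2)) :=
  List.finRange P.n ×ˢ [special₁] ++ List.finRange P.n ×ˢ [special₂] ++ normalSlots

/-- A reserved era lies in the lifespan of a block. -/
def Shared.Covers (S : Shared P Blk Loc) (s : Fin P.n × Fin (P.maxHes + 2)) (blk : Blk) : Prop :=
  (S.allocEra blk : ℕ∞) ≤ (S.resv s.1 s.2).1 ∧ (S.resv s.1 s.2).1 ≤ (S.retireEra blk : ℕ∞)

open Classical in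
/-- One step inside `cleanup()`. -/
noncomputable def cleanupStep (l : CleanupLine P Blk) (S : Shared P Blk Loc)
    (L : Local P Blk Loc) : Shared P Blk Loc × Local P Blk Loc :=
  let go (l' : CleanupLine P Blk) : Local P Blk Loc := L.goto (.cleanup l')
  match l with
  | .next kept [] => (S, { L with retireList := kept, pc := .app })
  | .next kept (blk :: rest) => (S, go (.scan kept rest blk S.counterEnd normalSlots))
  | .scan kept rest blk ce [] => (S, go (.readStart kept rest blk ce))
  | .scan kept rest blk ce (s :: todo) =>
      (S, go (if S.Covers s blk then .next (kept ++ [blk]) rest else .scan kept rest blk ce todo))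
  | .readStart kept rest blk ce =>
      if S.counterStart = ce then ({ S with live := S.live \ {blk} }, go (.next kept rest))
      else (S, go (.rescan kept rest blk rescanSlots))
  | .rescan kept rest blk [] => ({ S with live := S.live \ {blk} }, go (.next kept rest))
  | .rescan kept rest blk (s :: todo) =>
      (S, go (if S.Covers s blk then .next (kept ++ [blk]) rest else .rescan kept rest blk todo))

/-- One step of thread `t` inside `clear()`. -/
def clearStep (t : Fin P.n) (todo : List (Fin P.maxHes)) (S : Shared P Blk Loc)
    (L : Local P Blk Loc) : Shared P Blk Loc × Local P Blk Loc :=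
  match todo with
  | [] => (S, L.goto .app)
  | j :: rest => (S.setResvEra t (normal j) ⊤, L.goto (.clear rest))

/-- The first program counters of the four operations of the scheme. -/
inductive IsEntry : PC P Blk Loc → Prop
  | getProtected (a : Args P Blk Loc) : IsEntry (.getProtected a .start)
  | alloc : IsEntry (.alloc .start)
  | retire (blk : Blk) : IsEntry (.retire (.readEra blk))
  | clear : IsEntry (.clear (List.finRange P.maxHes))

/-- Replace the shared memory and the private memory of thread `t`. -/
def Config.set (c : Config P Blk Loc) (t : Fin P.n)
    (r : Shared P Blk Loc × Local P Blk Loc) : Config P Blk Loc :=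
  { shared := r.1, thread := Function.update c.thread t r.2 }

/-- `Step t c c'`: one step of thread `t` leads from `c` to `c'`. -/
inductive Step [DecidableEq Blk] (t : Fin P.n) (c : Config P Blk Loc) : Config P Blk Loc → Prop
  /-- The application may change its own references in any way; it has no access to the memory of
  the scheme. -/
  | app (h : (c.thread t).pc = .app) (heap' : Loc → Option Blk) :
      Step t c (c.set t ({ c.shared with heap := heap' }, c.thread t))
  /-- The application may call any operation with any arguments. -/
  | invoke (h : (c.thread t).pc = .app) (pc : PC P Blk Loc) (hpc : IsEntry pc) :
      Step t c (c.set t (c.shared, (c.thread t).goto pc))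
  | getProtected (a : Args P Blk Loc) (l : GPLine Blk)
      (h : (c.thread t).pc = .getProtected a l) :
      Step t c (c.set t (gpStep t a l c.shared (c.thread t)))
  | incrementEra (k : Caller) (l : IncLine P) (h : (c.thread t).pc = .incrementEra k l) :
      Step t c (c.set t (incStep k l c.shared (c.thread t)))
  | help (k : Caller) (i : Fin P.n) (j : Fin P.maxHes) (rest : List (Fin P.n × Fin P.maxHes))
      (l : HelpLine Blk Loc) (h : (c.thread t).pc = .help k i j rest l) :
      Step t c (c.set t (helpStep t k i j rest l c.shared (c.thread t)))
  | alloc (l : AllocLine Blk) (h : (c.thread t).pc = .alloc l) (hl : l ≠ .malloc) :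
      Step t c (c.set t (allocStep l c.shared (c.thread t)))
  /-- `malloc()` returns some block that is not allocated. -/
  | malloc (h : (c.thread t).pc = .alloc .malloc) (blk : Blk) (hblk : blk ∉ c.shared.live) :
      Step t c (c.set t ({ c.shared with live := insert blk c.shared.live },
        (c.thread t).goto (.alloc (.readEra blk))))
  | retire (l : RetireLine Blk) (h : (c.thread t).pc = .retire l) :
      Step t c (c.set t (retireStep l c.shared (c.thread t)))
  | cleanup (l : CleanupLine P Blk) (h : (c.thread t).pc = .cleanup l) :
      Step t c (c.set t (cleanupStep l c.shared (c.thread t)))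
  | clear (todo : List (Fin P.maxHes)) (h : (c.thread t).pc = .clear todo) :
      Step t c (c.set t (clearStep t todo c.shared (c.thread t)))

/-- The initial configurations.  The application's memory, the block headers and the unused fields
of the request records are arbitrary. -/
structure Config.Initial (c : Config P Blk Loc) : Prop where
  globalEra : c.shared.globalEra = 1
  counterStart : c.shared.counterStart = 0
  counterEnd : c.shared.counterEnd = 0
  resv : ∀ i s, c.shared.resv i s = (⊤, 0)
  result : ∀ i j, (c.shared.state i j).result = (.val none, ⊤)
  pc : ∀ t, (c.thread t).pc = .app
  allocCounter : ∀ t, (c.thread t).allocCounter = 0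
  retireCounter : ∀ t, (c.thread t).retireCounter = 0
  retireList : ∀ t, (c.thread t).retireList = []

end Code

/-- A finite execution: the threads are interleaved in an arbitrary way, so that each of them may
be arbitrarily slow or stop altogether.  `cfg k` and `who k` have no meaning beyond `length`. -/
structure Execution (P : Params) (Blk Loc : Type) [DecidableEq Blk] where
  length : ℕ
  cfg : ℕ → Config P Blk Loc
  /-- the thread that makes the step from `cfg k` to `cfg (k + 1)` -/
  who : ℕ → Fin P.n
  initial : (cfg 0).Initial
  step : ∀ k < length, Step (who k) (cfg k) (cfg (k + 1))

namespace Execution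

variable {P : Params} {Blk Loc : Type} [DecidableEq Blk] (e : Execution P Blk Loc)

/-- The program counter of thread `t` at time `k`. -/
def pc (t : Fin P.n) (k : ℕ) : PC P Blk Loc := ((e.cfg k).thread t).pc

/-- Step `s` is a call of `get_protected()` with arguments `a` by thread `t`. -/
def Invokes (t : Fin P.n) (a : Args P Blk Loc) (s : ℕ) : Prop :=
  s < e.length ∧ e.who s = t ∧ e.pc t s = .app ∧ e.pc t (s + 1) = .getProtected a .start

/-- The call of `get_protected()` that thread `t` made in step `s` has not returned by time `u`. -/
def Pending (t : Fin P.n) (s u : ℕ) : Prop :=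
  s < u ∧ u ≤ e.length ∧ ∀ k, s < k → k ≤ u → ∃ a l, e.pc t k = .getProtected a l

/-- The call of `get_protected()` that thread `t` made in step `s` returns in step `r`. -/
def Returns (t : Fin P.n) (s r : ℕ) : Prop :=
  e.Pending t s r ∧ r < e.length ∧ e.who r = t ∧ e.pc t (r + 1) = .app

open Classical in
/-- The number of steps after step `s` and before time `u` that thread `t` makes. -/
noncomputable def ownSteps (t : Fin P.n) (s u : ℕ) : ℕ :=
  ((Finset.Ioo s u).filter fun k => e.who k = t).card

open Classical in
/-- The number of iterations of the fast-path loop of `get_protected()` that thread `t` begins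
after step `s` and before time `u`. -/
noncomputable def fastAttempts (t : Fin P.n) (s u : ℕ) : ℕ :=
  ((Finset.Ioo s u).filter fun k => e.who k = t ∧
    ∃ a attempts prevEra, e.pc t k = .getProtected a (.fastDeref attempts prevEra)).card

open Classical in
/-- The number of iterations of the slow-path loop of `get_protected()` that thread `t` completes
after step `s` and before time `u` without success, i.e. that end with `resPtr == invptr`, so that
the loop is repeated. -/
noncomputable def slowRepeats (t : Fin P.n) (s u : ℕ) : ℕ :=
  ((Finset.Ioo s u).filter fun k => e.who k = t ∧
    ∃ a tag prevEra, e.pc t k = .getProtected a (.loopTest tag prevEra .invptr)).card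

end Execution

end WFE

/-! An iteration of the slow-path loop can fail only if the era differs from `prevEra`: if the two
agree and the request is still pending, the cancelling WCAS succeeds, and if the request is no
longer pending, the loop ends with the delivered result. So it suffices to bound the era increments
that a pending request can see.

While a request is pending, its owner lies between the two counter increments, so `counter_end <
counter_start`. A thread that starts `increment_era()` then cannot skip the scan, and it cannot get
past the slot of the request without serving it. Hence each thread increments the era at most once
during the pending period, namely if it was already past that slot, or was helping there with an
outdated tag. The owner increments nothing, which leaves at most `n - 1` increments. One more
failure is due to an era that is already outdated when the loop starts, so there are at most `n`
failures. `Step.serves` and `Step.slack_le` make this precise: `slack` is a potential that no step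
increases while the request is pending.

The argument needs the protocol to be sound: a pending request carries the current tag of its slot,
and a late helper cannot disturb a later cycle. This is `Inv`, preserved by steps outside
`get_protected()` (`Inv.step_background`) and inside it (`Inv.step_getProtected`).

Finally `Step.own` charges every own step to the potential `distance + 10 * repeats`, which steps of
other threads do not raise (`Step.repeats_le_of_ne`). Summing along the execution gives `account`,
from which all bounds are read off. -/

namespace WFE

variable {P : Params} {Blk Loc : Type}

/-! ### Vocabulary of slow-path cycles, requests and hand-overs -/

/-- The content of `state[i][j].result`. -/
def Config.result (c : Config P Blk Loc) (i : Fin P.n) (j : Fin P.maxHes) : Ptr Blk × ℕ∞ :=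
  (c.shared.state i j).result

/-- The tag of the normal reservation `j` of thread `i`. -/
def Config.tag (c : Config P Blk Loc) (i : Fin P.n) (j : Fin P.maxHes) : ℕ :=
  (c.shared.resv i (normal j)).2

/-- The program counter of a thread. -/
def Config.pc (c : Config P Blk Loc) (t : Fin P.n) : PC P Blk Loc := (c.thread t).pc

/-- The tag of the slow-path cycle of a line of the slow-path loop at which the request may still
be pending. -/
def GPLine.awaited : GPLine Blk → Option ℕ
  | .loopDeref tag _ => some tag
  | .loopCheck tag _ _ => some tag
  | .cancel tag _ _ _ => some tag
  | .loopPublish tag _ _ => some tag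
  | .loopResPtr tag _ => some tag
  | .loopTest tag _ .invptr => some tag
  | _ => none

/-- The tag of the slow-path cycle, from the publication of the request to the advance of the
tag. -/
def GPLine.cycle : GPLine Blk → Option ℕ
  | .loopDeref tag _ => some tag
  | .loopCheck tag _ _ => some tag
  | .cancel tag _ _ _ => some tag
  | .loopPublish tag _ _ => some tag
  | .loopResPtr tag _ => some tag
  | .loopTest tag _ _ => some tag
  | .cancelTag tag _ => some tag
  | .finishEra tag _ _ => some tag
  | .finishTag tag _ => some tag
  | _ => none

/-- The lines between the two increments of the slow-path counters. -/
def GPLine.counted : GPLine Blk → Bool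
  | .start => false
  | .fastDeref _ _ => false
  | .fastCheck _ _ _ => false
  | .fastPublish _ _ => false
  | .parentEra _ => false
  | .enter _ _ => false
  | _ => true

def PC.isGetProtected : PC P Blk Loc → Bool
  | .getProtected _ _ => true
  | _ => false

def PC.counted : PC P Blk Loc → Bool
  | .getProtected _ l => l.counted
  | _ => false

/-- The thread runs `get_protected()` with index `j`, in the slow-path cycle `tag`, with a request
that may still be pending. -/
def PC.Awaits (j : Fin P.maxHes) (tag : ℕ) : PC P Blk Loc → Prop
  | .getProtected a l => a.index = j ∧ l.awaited = some tag
  | _ => False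

/-- The thread runs `get_protected()` with index `j`, in the slow-path cycle `tag`. -/
def PC.InCycle (j : Fin P.maxHes) (tag : ℕ) : PC P Blk Loc → Prop
  | .getProtected a l => a.index = j ∧ l.cycle = some tag
  | _ => False

/-- The thread is about to publish a request with index `j` and tag `tag`. -/
def PC.Requests (j : Fin P.maxHes) (tag : ℕ) : PC P Blk Loc → Prop
  | .getProtected a (.request g _) => a.index = j ∧ g = tag
  | _ => False

/-- The thread has delivered the result of the slow-path cycle `tag` of slot `(i, j)` and tries to
advance the tag. -/
def PC.HandsOver (i : Fin P.n) (j : Fin P.maxHes) (tag : ℕ) : PC P Blk Loc → Prop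
  | .help _ i' j' _ (.handRead g _) => i' = i ∧ j' = j ∧ g = tag
  | .help _ i' j' _ (.handSwap g _ _) => i' = i ∧ j' = j ∧ g = tag
  | _ => False

/-- The reservation read before the hand-over carries the tag of the slow-path cycle. -/
def PC.SwapsTag : PC P Blk Loc → Prop
  | .help _ _ _ _ (.handSwap g _ old) => old.2 = g
  | _ => True

/-- The value of `counter_end` read by `increment_era()` is at most `m`. -/
def PC.EndLE (m : ℕ) : PC P Blk Loc → Prop
  | .incrementEra _ (.readStart ce) => ce ≤ m
  | _ => True

/-! ### Reading the shared memory after a write -/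

@[simp] theorem normal_inj {j j' : Fin P.maxHes} : normal j = normal j' ↔ j = j' := by
  simp [normal, Fin.ext_iff]

theorem Shared.setResv_resv (S : Shared P Blk Loc) (i i' : Fin P.n) (s s' : Fin (P.maxHes + 2))
    (v : ℕ∞ × ℕ) :
    (S.setResv i s v).resv i' s' = if i' = i ∧ s' = s then v else S.resv i' s' := by
  by_cases hi : i' = i
  · subst hi; simp [Shared.setResv, Function.update_apply]
  · simp [Shared.setResv, hi]

theorem Shared.setRequest_state (S : Shared P Blk Loc) (i i' : Fin P.n) (j j' : Fin P.maxHes)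
    (q : Request Blk Loc) :
    (S.setRequest i j q).state i' j' = if i' = i ∧ j' = j then q else S.state i' j' := by
  by_cases hi : i' = i
  · subst hi; simp [Shared.setRequest, Function.update_apply]
  · simp [Shared.setRequest, hi]

@[simp] theorem Shared.setResvEra_tag (S : Shared P Blk Loc) (i i' : Fin P.n)
    (s s' : Fin (P.maxHes + 2)) (era : ℕ∞) :
    ((S.setResvEra i s era).resv i' s').2 = (S.resv i' s').2 := by
  rw [Shared.setResvEra, Shared.setResv_resv]
  split_ifs with h
  · rw [h.1, h.2]
  · rfl

@[simp] theorem Shared.setResvEra_state (S : Shared P Blk Loc) (i : Fin P.n)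
    (s : Fin (P.maxHes + 2)) (era : ℕ∞) : (S.setResvEra i s era).state = S.state := rfl

@[simp] theorem Shared.setResv_state (S : Shared P Blk Loc) (i : Fin P.n)
    (s : Fin (P.maxHes + 2)) (v : ℕ∞ × ℕ) : (S.setResv i s v).state = S.state := rfl

@[simp] theorem Shared.setResvTag_state (S : Shared P Blk Loc) (i : Fin P.n)
    (s : Fin (P.maxHes + 2)) (g : ℕ) : (S.setResvTag i s g).state = S.state := rfl

@[simp] theorem Shared.setRequest_resv (S : Shared P Blk Loc) (i : Fin P.n) (j : Fin P.maxHes)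
    (q : Request Blk Loc) : (S.setRequest i j q).resv = S.resv := rfl

@[simp] theorem Shared.setResult_resv (S : Shared P Blk Loc) (i : Fin P.n) (j : Fin P.maxHes)
    (r : Ptr Blk × ℕ∞) : (S.setResult i j r).resv = S.resv := rfl

@[simp] theorem Shared.setResv_counters (S : Shared P Blk Loc) (i : Fin P.n)
    (s : Fin (P.maxHes + 2)) (v : ℕ∞ × ℕ) :
    (S.setResv i s v).counterStart = S.counterStart ∧
      (S.setResv i s v).counterEnd = S.counterEnd ∧
      (S.setResv i s v).globalEra = S.globalEra := ⟨rfl, rfl, rfl⟩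

@[simp] theorem Shared.setResvEra_counters (S : Shared P Blk Loc) (i : Fin P.n)
    (s : Fin (P.maxHes + 2)) (v : ℕ∞) :
    (S.setResvEra i s v).counterStart = S.counterStart ∧
      (S.setResvEra i s v).counterEnd = S.counterEnd ∧
      (S.setResvEra i s v).globalEra = S.globalEra := ⟨rfl, rfl, rfl⟩

@[simp] theorem Shared.setResvTag_counters (S : Shared P Blk Loc) (i : Fin P.n)
    (s : Fin (P.maxHes + 2)) (v : ℕ) :
    (S.setResvTag i s v).counterStart = S.counterStart ∧
      (S.setResvTag i s v).counterEnd = S.counterEnd ∧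
      (S.setResvTag i s v).globalEra = S.globalEra := ⟨rfl, rfl, rfl⟩

@[simp] theorem Shared.setRequest_counters (S : Shared P Blk Loc) (i : Fin P.n)
    (j : Fin P.maxHes) (q : Request Blk Loc) :
    (S.setRequest i j q).counterStart = S.counterStart ∧
      (S.setRequest i j q).counterEnd = S.counterEnd ∧
      (S.setRequest i j q).globalEra = S.globalEra := ⟨rfl, rfl, rfl⟩

@[simp] theorem Shared.setResult_counters (S : Shared P Blk Loc) (i : Fin P.n)
    (j : Fin P.maxHes) (r : Ptr Blk × ℕ∞) :
    (S.setResult i j r).counterStart = S.counterStart ∧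
      (S.setResult i j r).counterEnd = S.counterEnd ∧
      (S.setResult i j r).globalEra = S.globalEra := ⟨rfl, rfl, rfl⟩

theorem Shared.setResvTag_tag (S : Shared P Blk Loc) (i i' : Fin P.n) (j j' : Fin P.maxHes)
    (g : ℕ) : ((S.setResvTag i (normal j) g).resv i' (normal j')).2 =
      if i' = i ∧ j' = j then g else (S.resv i' (normal j')).2 := by
  rw [Shared.setResvTag, Shared.setResv_resv]
  simp only [normal_inj]
  split_ifs <;> rfl

theorem Shared.setResv_tag (S : Shared P Blk Loc) (i i' : Fin P.n) (j j' : Fin P.maxHes)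
    (v : ℕ∞ × ℕ) : ((S.setResv i (normal j) v).resv i' (normal j')).2 =
      if i' = i ∧ j' = j then v.2 else (S.resv i' (normal j')).2 := by
  rw [Shared.setResv_resv]
  simp only [normal_inj]
  split_ifs <;> rfl

theorem Shared.setResult_result (S : Shared P Blk Loc) (i i' : Fin P.n) (j j' : Fin P.maxHes)
    (r : Ptr Blk × ℕ∞) : ((S.setResult i j r).state i' j').result =
      if i' = i ∧ j' = j then r else (S.state i' j').result := by
  rw [Shared.setResult, Shared.setRequest_state]
  split_ifs <;> rfl

@[simp] theorem Config.set_pc_self (c : Config P Blk Loc) (t : Fin P.n)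
    (r : Shared P Blk Loc × Local P Blk Loc) : (c.set t r).pc t = r.2.pc := by
  simp [Config.set, Config.pc]

@[simp] theorem Config.set_shared (c : Config P Blk Loc) (t : Fin P.n)
    (r : Shared P Blk Loc × Local P Blk Loc) : (c.set t r).shared = r.1 := rfl

variable {p t : Fin P.n} {c c' : Config P Blk Loc}

/-! ### Steps outside `get_protected()` -/

/-- The effect of a step outside `get_protected()` on the slow-path protocol. -/
structure Background (p : Fin P.n) (c c' : Config P Blk Loc) : Prop where
  counterStart : c'.shared.counterStart = c.shared.counterStart
  counterEnd : c'.shared.counterEnd = c.shared.counterEnd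
  start : ∀ a l, c'.pc p = .getProtected a l → l = .start
  swapsTag : (c'.pc p).SwapsTag
  endLE : (c'.pc p).EndLE c.shared.counterEnd
  slot : ∀ i j,
    (c'.result i j = c.result i j ∧ c'.tag i j = c.tag i j ∧
        ∀ g, (c'.pc p).HandsOver i j g → (c.pc p).HandsOver i j g) ∨
      (∃ g : ℕ, c.result i j = (.invptr, (g : ℕ∞)) ∧ (c'.result i j).1 ≠ .invptr ∧
        c'.tag i j = c.tag i j ∧ ∀ g', (c'.pc p).HandsOver i j g' → g' = g) ∨
      (c'.result i j = c.result i j ∧ (c.pc p).HandsOver i j (c.tag i j) ∧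
        c'.tag i j = c.tag i j + 1 ∧ ∀ g', ¬ (c'.pc p).HandsOver i j g')

/-- A step that changes neither a result nor a tag and does not start a hand-over. -/
theorem Background.of_quiet (S : Shared P Blk Loc) (L : Local P Blk Loc)
    (hcs : S.counterStart = c.shared.counterStart) (hce : S.counterEnd = c.shared.counterEnd)
    (hst : S.state = c.shared.state)
    (hresv : ∀ i s, (S.resv i s).2 = (c.shared.resv i s).2)
    (hstart : ∀ a l, L.pc = .getProtected a l → l = .start)
    (hend : L.pc.EndLE c.shared.counterEnd) (hhand : ∀ i j g, ¬ L.pc.HandsOver i j g)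
    (hswap : L.pc.SwapsTag) : Background p c (c.set p (S, L)) where
  counterStart := hcs
  counterEnd := hce
  start a l h := hstart a l (by simpa using h)
  swapsTag := by simpa using hswap
  endLE := by simpa using hend
  slot i j := by
    left
    refine ⟨by simp [Config.result, hst], by simp [Config.tag, hresv], fun g hg => ?_⟩
    exact absurd (by simpa using hg) (hhand i j g)

variable [DecidableEq Blk]

theorem Step.pc_of_ne (h : Step p c c') {q : Fin P.n} (hq : q ≠ p) : c'.pc q = c.pc q := by
  cases h <;> simp [Config.set, Config.pc, hq]

/-- A step inside `get_protected()` is given by `gpStep`. -/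
theorem Step.of_getProtected (h : Step p c c') {a : Args P Blk Loc} {l : GPLine Blk}
    (hp : c.pc p = .getProtected a l) : c' = c.set p (gpStep p a l c.shared (c.thread p)) := by
  have hp' : (c.thread p).pc = .getProtected a l := hp
  cases h <;> simp_all

/-- Only two lines of a helper matter to a slot: the WCAS that delivers and the WCAS that hands
over. The latter raises the tag by exactly one because `SwapsTag` makes the expected pair `old`
carry the tag of the cycle. -/
theorem helpStep_slot (q : Fin P.n) (k : Caller) (i' : Fin P.n) (j' : Fin P.maxHes)
    (rest : List (Fin P.n × Fin P.maxHes)) (l : HelpLine Blk Loc) (S : Shared P Blk Loc)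
    (L : Local P Blk Loc) (hpc : L.pc = .help k i' j' rest l) (hs : L.pc.SwapsTag)
    (i : Fin P.n) (j : Fin P.maxHes) (S' : Shared P Blk Loc) (L' : Local P Blk Loc)
    (h : helpStep q k i' j' rest l S L = (S', L')) :
    S'.counterStart = S.counterStart ∧ S'.counterEnd = S.counterEnd ∧
    L'.pc.isGetProtected = false ∧ L'.pc.SwapsTag ∧ (∀ m, L'.pc.EndLE m) ∧
    (((S'.state i j).result = (S.state i j).result ∧
        (S'.resv i (normal j)).2 = (S.resv i (normal j)).2 ∧
        ∀ g, L'.pc.HandsOver i j g → L.pc.HandsOver i j g) ∨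
      (∃ g : ℕ, (S.state i j).result = (.invptr, (g : ℕ∞)) ∧ (S'.state i j).result.1 ≠ .invptr ∧
        (S'.resv i (normal j)).2 = (S.resv i (normal j)).2 ∧
        ∀ g', L'.pc.HandsOver i j g' → g' = g) ∨
      ((S'.state i j).result = (S.state i j).result ∧
        L.pc.HandsOver i j (S.resv i (normal j)).2 ∧
        (S'.resv i (normal j)).2 = (S.resv i (normal j)).2 + 1 ∧
        ∀ g', ¬ L'.pc.HandsOver i j g')) := by
  cases l <;> simp only [helpStep, Local.goto] at h <;> (try split at h) <;>
    obtain ⟨rfl, rfl⟩ := Prod.mk.inj h <;>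
    simp [PC.isGetProtected, PC.SwapsTag, PC.EndLE, PC.HandsOver, hpc] at hs ⊢
  all_goals grind [Shared.setResult_result, Shared.setResv_tag, Shared.setResv_counters,
    Shared.setResvEra_counters, Shared.setResult_counters]

/-- Apart from `help_thread()`, these operations write neither results nor tags (`clear()` resets
only eras), so every other case is quiet. -/
theorem Step.background (h : Step p c c') (hp : (c.pc p).isGetProtected = false)
    (hs : (c.pc p).SwapsTag) : Background p c c' := by
  cases h with
  | app h heap' =>
    apply Background.of_quiet <;> simp [h, PC.EndLE, PC.SwapsTag, PC.HandsOver]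
  | invoke h pc hpc =>
    cases hpc <;> apply Background.of_quiet <;>
      simp [Local.goto, PC.EndLE, PC.SwapsTag, PC.HandsOver]
  | getProtected a l h => simp [Config.pc, h, PC.isGetProtected] at hp
  | incrementEra k l h =>
    cases k <;> rcases l with _ | _ | (_ | ⟨⟨i, j⟩, rest⟩) | _ <;> simp only [incStep] <;>
      (try split) <;>
      apply Background.of_quiet <;>
      (try simp only [Local.goto, PC.EndLE, PC.SwapsTag, PC.HandsOver]) <;> grind
  | help k i j rest l h =>
    rcases hr : helpStep p k i j rest l c.shared (c.thread p) with ⟨S', L'⟩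
    have key := fun i' j' => helpStep_slot p k i j rest l c.shared (c.thread p) h hs i' j' S' L' hr
    obtain ⟨h1, h2, h4, h5, h6, -⟩ := key i j
    refine ⟨h1, h2, ?_, ?_, ?_, fun i' j' => ?_⟩
    · intro a l hl
      rw [Config.set_pc_self] at hl
      simp only at hl
      simp [hl, PC.isGetProtected] at h4
    · simpa using h5
    · simpa using h6 _
    · simp only [Config.set_pc_self]
      exact (key i' j').2.2.2.2.2
  | alloc l h hl =>
    cases l <;> simp only [allocStep] <;> apply Background.of_quiet <;>
      (try simp only [Local.goto, Local.done, PC.EndLE, PC.SwapsTag, PC.HandsOver]) <;>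
      (try split) <;> grind [PC.EndLE, PC.SwapsTag, PC.HandsOver]
  | malloc h blk hblk =>
    apply Background.of_quiet <;> simp [Local.goto, PC.EndLE, PC.SwapsTag, PC.HandsOver]
  | retire l h =>
    cases l <;> simp only [retireStep] <;> apply Background.of_quiet <;>
      (try simp only [Local.goto, PC.EndLE, PC.SwapsTag, PC.HandsOver]) <;>
      (try split) <;> grind [PC.EndLE, PC.SwapsTag, PC.HandsOver]
  | cleanup l h =>
    rcases l with ⟨_, _ | _⟩ | ⟨_, _, _, _, _ | _⟩ | _ | ⟨_, _, _, _ | _⟩ <;>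
      simp only [cleanupStep] <;> (try split) <;> apply Background.of_quiet <;>
      simp [Local.goto, PC.EndLE, PC.SwapsTag, PC.HandsOver]
  | clear todo h =>
    rcases todo with _ | _ <;> simp only [clearStep] <;> apply Background.of_quiet <;>
      simp [Local.goto, PC.EndLE, PC.SwapsTag, PC.HandsOver]

/-! ### The invariant of the slow-path protocol -/

/-- The number of threads between the two increments of the slow-path counters. -/
def Config.inSlowPath (c : Config P Blk Loc) : ℕ :=
  (Finset.univ.filter fun q => (c.pc q).counted = true).card

/-- The invariant of the slow-path protocol. -/
structure Inv (c : Config P Blk Loc) : Prop where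
  counters : c.shared.counterStart = c.shared.counterEnd + c.inSlowPath
  endLE : ∀ q, (c.pc q).EndLE c.shared.counterEnd
  swapsTag : ∀ q, (c.pc q).SwapsTag
  pending : ∀ i j, (c.result i j).1 = .invptr →
    ∃ g : ℕ, c.result i j = (.invptr, (g : ℕ∞)) ∧ c.tag i j = g ∧ (c.pc i).Awaits j g
  -- The second case arises when a helper has advanced the tag before the owner does.
  cycle : ∀ i j g, (c.pc i).InCycle j g → c.tag i j = g ∨ c.tag i j = g + 1
  requests : ∀ i j g, (c.pc i).Requests j g → c.tag i j = g
  -- Either the helper is late, and the larger tag defeats its WCAS, or the owner is still in the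
  -- cycle that the helper serves. Thus no hand-over changes the tag between the owner's reading of
  -- it and the publication of the request.
  handsOver : ∀ q i j g, (c.pc q).HandsOver i j g →
    g < c.tag i j ∨ g = c.tag i j ∧ (c.result i j).1 ≠ .invptr ∧ (c.pc i).InCycle j g

omit [DecidableEq Blk] in
theorem Inv.of_initial (h : c.Initial) : Inv c := by
  have hpc : ∀ q, c.pc q = .app := h.pc
  constructor
  · simp [Config.inSlowPath, hpc, PC.counted, h.counterStart, h.counterEnd]
  · simp [hpc, PC.EndLE]
  · simp [hpc, PC.SwapsTag]
  · simp [Config.result, h.result]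
  · simp [hpc, PC.InCycle]
  · simp [hpc, PC.Requests]
  · simp [hpc, PC.HandsOver]

theorem Step.inSlowPath_of_eq (h : Step p c c') (hc : (c'.pc p).counted = (c.pc p).counted) :
    c'.inSlowPath = c.inSlowPath := by
  unfold Config.inSlowPath
  congr 1
  ext q
  by_cases hq : q = p
  · subst hq; simp [hc]
  · simp [h.pc_of_ne hq]

theorem Step.inSlowPath_of_enter (h : Step p c c') (hc : (c.pc p).counted = false)
    (hc' : (c'.pc p).counted = true) : c'.inSlowPath = c.inSlowPath + 1 := by
  unfold Config.inSlowPath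
  rw [← Finset.card_insert_of_notMem (a := p) (by simp [hc])]
  congr 1
  ext q
  by_cases hq : q = p
  · subst hq; simp [hc']
  · simp [h.pc_of_ne hq, hq]

theorem Step.inSlowPath_of_leave (h : Step p c c') (hc : (c.pc p).counted = true)
    (hc' : (c'.pc p).counted = false) : c.inSlowPath = c'.inSlowPath + 1 := by
  unfold Config.inSlowPath
  rw [← Finset.card_insert_of_notMem (a := p) (by simp [hc'])]
  congr 1
  ext q
  by_cases hq : q = p
  · subst hq; simp [hc]
  · simp [h.pc_of_ne hq, hq]

omit [DecidableEq Blk] in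
theorem Inv.of_pending (hi : Inv c) {i : Fin P.n} {j : Fin P.maxHes} {g : ℕ}
    (h : c.result i j = (.invptr, (g : ℕ∞))) : c.tag i j = g ∧ (c.pc i).Awaits j g := by
  obtain ⟨g', h1, h2, h3⟩ := hi.pending i j (by rw [h])
  have : g = g' := by
    rw [h, Prod.mk.injEq] at h1
    exact_mod_cast h1.2
  subst this
  exact ⟨h2, h3⟩

omit [DecidableEq Blk] in
theorem PC.Requests.not_inCycle {pc : PC P Blk Loc} {j : Fin P.maxHes} {g g' : ℕ}
    (h : pc.Requests j g) : ¬ pc.InCycle j g' := by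
  cases pc with
  | getProtected a l => cases l <;> simp_all [PC.Requests, PC.InCycle, GPLine.cycle]
  | _ => simp [PC.InCycle]

omit [DecidableEq Blk] in
theorem PC.InCycle.unique {pc : PC P Blk Loc} {j : Fin P.maxHes} {g g' : ℕ}
    (h : pc.InCycle j g) (h' : pc.InCycle j g') : g = g' := by
  cases pc <;> simp_all [PC.InCycle]

omit [DecidableEq Blk] in
theorem PC.Awaits.inCycle {pc : PC P Blk Loc} {j : Fin P.maxHes} {g : ℕ}
    (h : pc.Awaits j g) : pc.InCycle j g := by
  cases pc with
  | getProtected a l =>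
    simp only [PC.InCycle, PC.Awaits] at h ⊢
    unfold GPLine.awaited GPLine.cycle at *
    grind
  | _ => simp_all [PC.Awaits]

/-- The case to watch is a hand-over. By `handsOver` the request is then no longer pending and the
owner is in the cycle, so `pending` and `requests` are not at stake; the tag becomes `g + 1`, as
`cycle` allows, and every other helper of this cycle becomes late. -/
theorem Inv.step_background (hi : Inv c) (h : Step p c c')
    (hp : (c.pc p).isGetProtected = false) : Inv c' := by
  have hb := h.background hp (hi.swapsTag p)
  have hne : ∀ q, q ≠ p → c'.pc q = c.pc q := fun q hq => h.pc_of_ne hq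
  have hcyc : ∀ j g, ¬ (c.pc p).InCycle j g := by
    intro j g; cases hpc : c.pc p <;> simp_all [PC.isGetProtected, PC.InCycle]
  have haw : ∀ j g, ¬ (c.pc p).Awaits j g := by
    intro j g; cases hpc : c.pc p <;> simp_all [PC.isGetProtected, PC.Awaits]
  have hcyc' : ∀ j g, ¬ (c'.pc p).InCycle j g := by
    intro j g
    cases hpc : c'.pc p with
    | getProtected a l => simp [hb.start a l hpc, PC.InCycle, GPLine.cycle]
    | _ => simp [PC.InCycle]
  have hreq' : ∀ j g, ¬ (c'.pc p).Requests j g := by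
    intro j g
    cases hpc : c'.pc p with
    | getProtected a l => simp [hb.start a l hpc, PC.Requests]
    | _ => simp [PC.Requests]
  have hcount : (c'.pc p).counted = (c.pc p).counted := by
    have h1 : (c.pc p).counted = false := by
      cases hpc : c.pc p <;> simp_all [PC.isGetProtected, PC.counted]
    rw [h1]
    cases hpc : c'.pc p with
    | getProtected a l => simp [hb.start a l hpc, PC.counted, GPLine.counted]
    | _ => simp [PC.counted]
  have hreqcyc := fun i j g g' =>
    PC.Requests.not_inCycle (pc := c.pc i) (j := j) (g := g) (g' := g')
  have hunique := fun i j g g' =>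
    PC.InCycle.unique (pc := c.pc i) (j := j) (g := g) (g' := g')
  have hawcyc := fun i j g => PC.Awaits.inCycle (pc := c.pc i) (j := j) (g := g)
  refine ⟨?_, ?_, ?_, ?_, ?_, ?_, ?_⟩
  · rw [hb.counterStart, hb.counterEnd, h.inSlowPath_of_eq hcount]
    exact hi.counters
  · intro q
    rw [hb.counterEnd]
    by_cases hq : q = p
    · subst hq; exact hb.endLE
    · rw [hne q hq]; exact hi.endLE q
  · intro q
    by_cases hq : q = p
    · subst hq; exact hb.swapsTag
    · rw [hne q hq]; exact hi.swapsTag q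
  · intro i j
    have := hb.slot i j
    have := hi.pending i j
    have := hi.handsOver p i j
    by_cases hq : i = p
    · subst hq; grind
    · rw [hne i hq]; grind
  · intro i j g
    have := hb.slot i j
    have := hi.cycle i j g
    have := hi.handsOver p i j
    by_cases hq : i = p
    · subst hq; grind
    · rw [hne i hq]; grind
  · intro i j g
    have := hb.slot i j
    have := hi.requests i j g
    have := hi.handsOver p i j
    by_cases hq : i = p
    · subst hq; grind
    · rw [hne i hq]; grind
  · intro q i j g
    have := hb.slot i j
    have := fun g => hi.of_pending (i := i) (j := j) (g := g)
    have := hi.handsOver p i j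
    have := hi.handsOver q i j
    by_cases hq : i = p <;> by_cases hq' : q = p
    · subst hq hq'; grind
    · subst hq; rw [hne q hq']; grind
    · subst hq'; rw [hne i hq]; grind
    · rw [hne i hq, hne q hq']; grind

/-- When the owner writes `tag + 1`, the tag is `tag` or already `tag + 1`, so tags never decrease.
The last two conclusions serve `handsOver`: when the owner ends its cycle, a helper still handing
over becomes late. -/
theorem gpStep_slot (p : Fin P.n) (a : Args P Blk Loc) (l : GPLine Blk) (S S' : Shared P Blk Loc)
    (L L' : Local P Blk Loc) (hr : gpStep p a l S L = (S', L')) (hpc : L.pc = .getProtected a l)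
    (j : Fin P.maxHes)
    (hpend : (S.state p j).result.1 = .invptr →
      ∃ g : ℕ, (S.state p j).result = (.invptr, (g : ℕ∞)) ∧
      (S.resv p (normal j)).2 = g ∧ L.pc.Awaits j g)
    (hcyc : ∀ g, L.pc.InCycle j g → (S.resv p (normal j)).2 = g ∨ (S.resv p (normal j)).2 = g + 1)
    (hreq : ∀ g, L.pc.Requests j g → (S.resv p (normal j)).2 = g) :
    ((S'.state p j).result.1 = .invptr → ∃ g : ℕ, (S'.state p j).result = (.invptr, (g : ℕ∞)) ∧
      (S'.resv p (normal j)).2 = g ∧ L'.pc.Awaits j g) ∧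
    (∀ g, L'.pc.InCycle j g → (S'.resv p (normal j)).2 = g ∨ (S'.resv p (normal j)).2 = g + 1) ∧
    (∀ g, L'.pc.Requests j g → (S'.resv p (normal j)).2 = g) ∧
    (S.resv p (normal j)).2 ≤ (S'.resv p (normal j)).2 ∧
    (∀ g, (S.state p j).result.1 ≠ .invptr → L.pc.InCycle j g → g = (S.resv p (normal j)).2 →
      g < (S'.resv p (normal j)).2 ∨ g = (S'.resv p (normal j)).2 ∧
        (S'.state p j).result.1 ≠ .invptr ∧ L'.pc.InCycle j g) := by
  by_cases hj : a.index = j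
  · cases l <;> simp only [gpStep, Local.goto, Local.done] at hr <;> (try split at hr) <;>
      obtain ⟨rfl, rfl⟩ := Prod.mk.inj hr <;>
      simp only [hpc, PC.Awaits, PC.InCycle, PC.Requests, GPLine.awaited, GPLine.cycle, hj,
        true_and, Option.some.injEq, forall_eq'] at * <;>
      grind [Shared.setResult_result, Shared.setResv_tag, Shared.setResvTag_tag,
        Shared.setRequest_state, Shared.setResvEra_tag,
        Shared.setResvEra_state, Shared.setResv_state, Shared.setResvTag_state,
        Shared.setRequest_resv, Shared.setResult_resv, GPLine.awaited]
  · cases l <;> simp only [gpStep, Local.goto, Local.done] at hr <;> (try split at hr) <;>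
      obtain ⟨rfl, rfl⟩ := Prod.mk.inj hr <;>
      simp only [hpc, PC.Awaits, PC.InCycle, PC.Requests, GPLine.awaited, GPLine.cycle] at * <;>
      grind [Shared.setResult_result, Shared.setResv_tag, Shared.setResvTag_tag,
        Shared.setRequest_state, Shared.setResvEra_tag,
        Shared.setResvEra_state, Shared.setResv_state, Shared.setResvTag_state,
        Shared.setRequest_resv, Shared.setResult_resv, GPLine.awaited]

theorem gpStep_slot_of_ne (p : Fin P.n) (a : Args P Blk Loc) (l : GPLine Blk)
    (S : Shared P Blk Loc) (L : Local P Blk Loc) {i : Fin P.n} (hi : i ≠ p)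
    (j : Fin P.maxHes) :
    ((gpStep p a l S L).1.state i j).result = (S.state i j).result ∧
      ((gpStep p a l S L).1.resv i (normal j)).2 = (S.resv i (normal j)).2 := by
  cases l <;> simp only [gpStep] <;> (try split) <;>
    simp [Shared.setResult_result, Shared.setResv_tag, Shared.setResvTag_tag,
      Shared.setRequest_state, hi]

theorem helpStep_globalEra (q : Fin P.n) (k : Caller) (i : Fin P.n) (j : Fin P.maxHes)
    (rest : List (Fin P.n × Fin P.maxHes)) (l : HelpLine Blk Loc) (S : Shared P Blk Loc)
    (L : Local P Blk Loc) : (helpStep q k i j rest l S L).1.globalEra = S.globalEra := by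
  cases l <;> simp only [helpStep] <;> (try split) <;> rfl

theorem gpStep_pc (p : Fin P.n) (a : Args P Blk Loc) (l : GPLine Blk)
    (S : Shared P Blk Loc) (L : Local P Blk Loc) :
    (gpStep p a l S L).2.pc = .app ∨ ∃ l', (gpStep p a l S L).2.pc = .getProtected a l' := by
  cases l <;> simp only [gpStep, Local.goto, Local.done] <;> (try split) <;> simp

theorem gpStep_counters (p : Fin P.n) (a : Args P Blk Loc) (l : GPLine Blk)
    (S : Shared P Blk Loc) (L : Local P Blk Loc) :
    (gpStep p a l S L).1.globalEra = S.globalEra ∧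
    ((gpStep p a l S L).1.counterStart = S.counterStart ∧
        (gpStep p a l S L).1.counterEnd = S.counterEnd ∧
        (gpStep p a l S L).2.pc.counted = l.counted ∨
      (gpStep p a l S L).1.counterStart = S.counterStart + 1 ∧
        (gpStep p a l S L).1.counterEnd = S.counterEnd ∧
        l.counted = false ∧ (gpStep p a l S L).2.pc.counted = true ∨
      (gpStep p a l S L).1.counterStart = S.counterStart ∧
        (gpStep p a l S L).1.counterEnd = S.counterEnd + 1 ∧
        l.counted = true ∧ (gpStep p a l S L).2.pc.counted = false) := by
  cases l <;> simp only [gpStep, Local.goto, Local.done] <;> (try split) <;>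
    simp [PC.counted, GPLine.counted]

theorem Inv.step_getProtected (hi : Inv c) (h : Step p c c') {a : Args P Blk Loc}
    {l : GPLine Blk} (hp : c.pc p = .getProtected a l) : Inv c' := by
  have hne : ∀ q, q ≠ p → c'.pc q = c.pc q := fun q hq => h.pc_of_ne hq
  have heq := h.of_getProtected hp
  have hpc' : c'.pc p = .app ∨ ∃ l', c'.pc p = .getProtected a l' := by
    rw [heq, Config.set_pc_self]; exact gpStep_pc ..
  have hother : ∀ i, i ≠ p → ∀ j, c'.result i j = c.result i j ∧ c'.tag i j = c.tag i j := by
    intro i hi j; rw [heq]; exact gpStep_slot_of_ne _ _ _ _ _ hi j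
  have hself := fun j => gpStep_slot p a l c.shared c'.shared (c.thread p) (c'.thread p)
    (by rw [heq]; simp [Config.set]) hp j (hi.pending p j) (hi.cycle p j) (hi.requests p j)
  have hhand : ∀ i j g, ¬ (c'.pc p).HandsOver i j g := by
    rcases hpc' with h | ⟨l', h⟩ <;> simp [h, PC.HandsOver]
  obtain ⟨-, hcount⟩ := gpStep_counters p a l c.shared (c.thread p)
  have hl : (c.pc p).counted = l.counted := by rw [hp]; rfl
  have hl' : (c'.pc p).counted = (gpStep p a l c.shared (c.thread p)).2.pc.counted := by
    rw [heq, Config.set_pc_self]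
  rw [← hl', ← hl] at hcount
  have hsh : c'.shared = (gpStep p a l c.shared (c.thread p)).1 := by rw [heq]; rfl
  rw [← hsh] at hcount
  refine ⟨?_, ?_, ?_, ?_, ?_, ?_, ?_⟩
  · have := hi.counters
    rcases hcount with ⟨h1, h2, h3⟩ | ⟨h1, h2, h3, h4⟩ | ⟨h1, h2, h3, h4⟩
    · have := h.inSlowPath_of_eq h3; omega
    · have := h.inSlowPath_of_enter h3 h4; omega
    · have := h.inSlowPath_of_leave h3 h4; omega
  · intro q
    by_cases hq : q = p
    · subst hq; rcases hpc' with h | ⟨l', h⟩ <;> simp [h, PC.EndLE]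
    · rw [hne q hq]
      have := hi.endLE q
      -- A value of `counter_end` read earlier stays a lower bound, since the counter never
      -- decreases.
      cases hpc : c.pc q with
      | incrementEra k l =>
        cases l <;> simp only [hpc, PC.EndLE] at this ⊢
        omega
      | _ => simp [PC.EndLE]
  · intro q
    by_cases hq : q = p
    · subst hq; rcases hpc' with h | ⟨l', h⟩ <;> simp [h, PC.SwapsTag]
    · rw [hne q hq]; exact hi.swapsTag q
  · intro i j
    by_cases hq : i = p
    · subst hq; exact (hself j).1
    · rw [hne i hq, (hother i hq j).1, (hother i hq j).2]; exact hi.pending i j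
  · intro i j g
    by_cases hq : i = p
    · subst hq; exact (hself j).2.1 g
    · rw [hne i hq, (hother i hq j).2]; exact hi.cycle i j g
  · intro i j g
    by_cases hq : i = p
    · subst hq; exact (hself j).2.2.1 g
    · rw [hne i hq, (hother i hq j).2]; exact hi.requests i j g
  · intro q i j g hg
    by_cases hq' : q = p
    · subst hq'; exact absurd hg (hhand i j g)
    rw [hne q hq'] at hg
    have hold := hi.handsOver q i j g hg
    by_cases hq : i = p
    · subst hq
      rcases hold with h1 | ⟨h1, h2, h3⟩
      · exact Or.inl (h1.trans_le (hself j).2.2.2.1)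
      · exact (hself j).2.2.2.2 g h2 h3 h1
    · rw [hne i hq, (hother i hq j).1, (hother i hq j).2]; exact hold

theorem Inv.step (hi : Inv c) (h : Step p c c') : Inv c' := by
  cases hpc : c.pc p with
  | getProtected a l => exact hi.step_getProtected h hpc
  | _ => exact hi.step_background h (by simp [hpc, PC.isGetProtected])

theorem Execution.inv (e : Execution P Blk Loc) {k : ℕ} (hk : k ≤ e.length) : Inv (e.cfg k) := by
  induction k with
  | zero => exact Inv.of_initial e.initial
  | succ k ih => exact (ih (by omega)).step (e.step k (by omega))

/-! ### Era increments while a request is pending -/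

/-- The lines of `help_thread()` from which the thread does not leave before the request with tag
`tag` has been served. -/
def HelpLine.Serves (tag : ℕ) : HelpLine Blk Loc → Prop
  | .readResult => True
  | .readEra g => g = tag
  | .reserveParent g _ => g = tag
  | .readPointer g => g = tag
  | .checkTag g _ => g = tag
  | .firstEra g _ => g = tag
  | .reserve g _ _ => g = tag
  | .deref g _ _ => g = tag
  | .checkEra g _ _ _ => g = tag
  | .deliver g _ _ => g = tag
  | .loopTest g _ _ => g = tag
  | _ => False

/-- The thread does not increment the era before the pending request `(t, j)` with tag `tag` has
been served. -/
def PC.Serves (t : Fin P.n) (j : Fin P.maxHes) (tag : ℕ) : PC P Blk Loc → Prop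
  | .incrementEra _ (.scan todo) => (t, j) ∈ todo
  | .incrementEra _ .bump => False
  | .help _ i' j' rest l => (t, j) ∈ rest ∨ (i' = t ∧ j' = j ∧ l.Serves tag)
  | _ => True

open Classical in
/-- The number of threads that may increment the era although the request `(t, j)` with tag `tag`
is pending. -/
noncomputable def Config.bumpers (c : Config P Blk Loc) (t : Fin P.n) (j : Fin P.maxHes)
    (tag : ℕ) : ℕ :=
  (Finset.univ.filter fun q => ¬ (c.pc q).Serves t j tag).card

omit [DecidableEq Blk] in
theorem PC.Serves.of_getProtected {pc : PC P Blk Loc} (h : pc.isGetProtected = true)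
    (t : Fin P.n) (j : Fin P.maxHes) (tag : ℕ) : pc.Serves t j tag := by
  cases pc <;> simp_all [PC.isGetProtected, PC.Serves]

theorem mem_allSlots (t : Fin P.n) (j : Fin P.maxHes) : (t, j) ∈ allSlots (P := P) := by
  simp [allSlots, List.mem_product]

/-- A helper with the current tag passes the tag check by `htag` and stays in its loop by `hres`.
Its delivering WCAS would succeed, which `hres'` excludes. A helper of another slot returns to a
scan that still contains `(t, j)`. -/
theorem helpStep_serves (q : Fin P.n) (k : Caller) (i' : Fin P.n) (j' : Fin P.maxHes)
    (rest : List (Fin P.n × Fin P.maxHes)) (l : HelpLine Blk Loc) (S : Shared P Blk Loc)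
    (L : Local P Blk Loc) (hpc : L.pc = .help k i' j' rest l) {j : Fin P.maxHes} {tag : ℕ}
    (hres : (S.state t j).result = (.invptr, (tag : ℕ∞))) (htag : (S.resv t (normal j)).2 = tag)
    (hres' : ((helpStep q k i' j' rest l S L).1.state t j).result.1 = .invptr)
    (hs : L.pc.Serves t j tag) : (helpStep q k i' j' rest l S L).2.pc.Serves t j tag := by
  cases l <;> simp only [helpStep, Local.goto] at hres' ⊢ <;> (try split at hres') <;>
    simp only [hpc, PC.Serves, HelpLine.Serves] at hs ⊢ <;>
    grind [Shared.setResult_result, PC.Serves, HelpLine.Serves, Nat.cast_inj (R := ℕ∞)]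

/-- The only step that changes the era is the last one of `increment_era()`. It is made by a thread
that does not serve the request and takes it to code from which it must scan all slots before the
next increment, so each increment uses up one such thread. -/
theorem Step.serves (h : Step p c c') {j : Fin P.maxHes} {tag : ℕ}
    (hend : (c.pc p).EndLE c.shared.counterEnd)
    (hlt : c.shared.counterEnd < c.shared.counterStart)
    (hres : c.result t j = (.invptr, (tag : ℕ∞))) (htag : c.tag t j = tag)
    (hres' : (c'.result t j).1 = .invptr) :
    (c'.shared.globalEra = c.shared.globalEra ∧
      ((c.pc p).Serves t j tag → (c'.pc p).Serves t j tag)) ∨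
    (c'.shared.globalEra = c.shared.globalEra + 1 ∧ ¬ (c.pc p).Serves t j tag ∧
      (c'.pc p).Serves t j tag) := by
  cases h with
  | app h heap' => simp [h, PC.Serves]
  | invoke h pc hpc => cases hpc <;> simp [Local.goto, PC.Serves]
  | getProtected a l h =>
    left
    refine ⟨(gpStep_counters p a l c.shared (c.thread p)).1, fun _ => ?_⟩
    rw [Config.set_pc_self]
    rcases gpStep_pc p a l c.shared (c.thread p) with h | ⟨l', h⟩ <;> simp [h, PC.Serves]
  | incrementEra k l h =>
    have hpc : c.pc p = .incrementEra k l := h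
    rw [hpc] at hend ⊢
    rw [Config.set_pc_self]
    -- At `readStart`, the value read satisfies `ce ≤ counterEnd < counterStart`, so the scan is not
    -- skipped and starts with all slots, `(t, j)` among them.
    have := mem_allSlots t j
    cases k <;> rcases l with _ | _ | (_ | ⟨⟨i, j⟩, rest⟩) | _ <;> simp only [incStep] <;>
      (try split) <;>
      simp_all [Local.goto, PC.EndLE, PC.Serves, HelpLine.Serves, Config.result] <;>
      grind [PC.Serves]
  | help k i j rest l h =>
    left
    refine ⟨(helpStep_globalEra ..), ?_⟩
    rw [Config.set_pc_self]
    exact helpStep_serves p k i j rest l c.shared (c.thread p) h hres htag hres'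
  | alloc l h hl =>
    left
    rw [Config.set_pc_self]
    cases l <;> simp only [allocStep] <;>
      simp [Local.goto, Local.done, PC.Serves] <;> grind [PC.Serves]
  | malloc h blk hblk => simp [Local.goto, PC.Serves]
  | retire l h =>
    left
    rw [Config.set_pc_self]
    cases l <;> simp only [retireStep] <;> simp [Local.goto, PC.Serves] <;> grind [PC.Serves]
  | cleanup l h =>
    left
    rw [Config.set_pc_self]
    rcases l with ⟨_, _ | _⟩ | ⟨_, _, _, _, _ | _⟩ | _ | ⟨_, _, _, _ | _⟩ <;>
      simp only [cleanupStep] <;> (try split) <;> simp [Local.goto, PC.Serves]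
  | clear todo h =>
    left
    rw [Config.set_pc_self]
    rcases todo with _ | _ <;> simp [clearStep, Local.goto, PC.Serves, Shared.setResvEra_counters]

theorem Step.bumpers_le (h : Step p c c') {j : Fin P.maxHes} {tag : ℕ}
    (hs : (c.pc p).Serves t j tag → (c'.pc p).Serves t j tag) :
    c'.bumpers t j tag ≤ c.bumpers t j tag := by
  apply Finset.card_le_card
  intro q
  by_cases hq : q = p
  · subst hq; simpa using mt hs
  · simp [h.pc_of_ne hq]

theorem Step.bumpers_lt (h : Step p c c') {j : Fin P.maxHes} {tag : ℕ}
    (hs : ¬ (c.pc p).Serves t j tag) (hs' : (c'.pc p).Serves t j tag) :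
    c'.bumpers t j tag < c.bumpers t j tag := by
  apply Finset.card_lt_card
  refine ⟨fun q => ?_, fun hsub => ?_⟩
  · by_cases hq : q = p
    · subst hq; simp [hs']
    · simp [h.pc_of_ne hq]
  · have := hsub (x := p) (by simpa using hs)
    simp [hs'] at this

omit [DecidableEq Blk] in
-- The owner itself is not counted. The strict inequality leaves room for the extra 1 in `slack`, so
-- that the bound is `n` and not `n + 1`.
theorem Config.bumpers_lt {j : Fin P.maxHes} {tag : ℕ}
    (hs : (c.pc t).isGetProtected = true) : c.bumpers t j tag < P.n := by
  conv_rhs => rw [← Fintype.card_fin P.n]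
  apply Finset.card_lt_univ_of_notMem (x := t)
  simpa using PC.Serves.of_getProtected hs t j tag

/-- A bound on the changes of the era that the pending request `(t, j)` can still see: the
increments to come, and one that a thread which last read `prevEra` has not noticed yet. -/
noncomputable def Config.slack (c : Config P Blk Loc) (t : Fin P.n) (j : Fin P.maxHes)
    (tag : ℕ) (prevEra : ℕ∞) : ℕ :=
  c.bumpers t j tag + if prevEra = (c.shared.globalEra : ℕ∞) then 0 else 1

theorem Step.slack_le (h : Step p c c') (hi : Inv c) {a : Args P Blk Loc} {l : GPLine Blk}
    (ht : c.pc t = .getProtected a l) {j : Fin P.maxHes} {tag : ℕ}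
    (hres : c.result t j = (.invptr, (tag : ℕ∞)))
    (hres' : (c'.result t j).1 = .invptr) (prevEra : ℕ∞) :
    c'.slack t j tag prevEra ≤ c.slack t j tag prevEra := by
  -- The owner of the pending request is itself between the two counter increments.
  have hlt : c.shared.counterEnd < c.shared.counterStart := by
    rw [hi.counters]
    have hmem : t ∈ Finset.univ.filter fun q => (c.pc q).counted = true := by
      have haw := (hi.of_pending hres).2
      rw [ht] at haw
      simp only [Finset.mem_filter, Finset.mem_univ, true_and, ht]
      cases l <;> simp_all [PC.Awaits, GPLine.awaited, PC.counted, GPLine.counted]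
    have := Finset.card_pos.2 ⟨t, hmem⟩
    unfold Config.inSlowPath
    omega
  unfold Config.slack
  rcases h.serves (hi.endLE p) hlt hres (hi.of_pending hres).1 hres' with ⟨h1, h2⟩ | ⟨h1, h2, h3⟩
  · rw [h1]
    have := h.bumpers_le h2
    omega
  -- An increment may make `prevEra` outdated, which costs 1; the loss of one bumper pays for it.
  · have := h.bumpers_lt h2 h3
    split_ifs <;> omega

/-- Only the owner publishes requests; helpers can only end them. -/
theorem Step.pending_of_ne (h : Step p c c') (hi : Inv c) (hp : t ≠ p) {j : Fin P.maxHes}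
    (hres' : (c'.result t j).1 = .invptr) : (c.result t j).1 = .invptr := by
  cases hpc : c.pc p with
  | getProtected a l =>
    have heq := h.of_getProtected hpc
    rw [heq] at hres'
    rw [← hres']
    exact congrArg Prod.fst (gpStep_slot_of_ne p a l c.shared (c.thread p) hp j).1.symm
  | _ =>
    have := (h.background (by simp [hpc, PC.isGetProtected]) (hi.swapsTag p)).slot t j
    grind

/-! ### The potential of a call -/

open Classical in
/-- A bound on the unsuccessful iterations of the slow-path loop still to come, where `pending`
says that the request is pending and `slack` bounds the visible changes of the era. -/
noncomputable def GPLine.repeats (n : ℕ) (pending : Prop) (slack : ℕ → ℕ∞ → ℕ) :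
    GPLine Blk → ℕ
  | .loopDeref tag e => if pending then slack tag e else 0
  | .loopCheck tag e _ => if pending then slack tag e else 0
  -- If the request is pending the WCAS succeeds, and otherwise the loop ends with the delivered
  -- result; either way no repetition follows.
  | .cancel _ _ _ _ => 0
  -- The `+ 1` is the current iteration, which may fail. At `loopTest` with `invptr` it is certain
  -- to fail, even if the result has been delivered since that read, so there the 1 is
  -- unconditional.
  | .loopPublish tag _ e => if pending then slack tag e + 1 else 0
  | .loopResPtr tag e => if pending then slack tag e + 1 else 0
  | .loopTest tag e .invptr => (if pending then slack tag e else 0) + 1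
  | .loopTest _ _ (.val _) => 0
  | .cancelTag _ _ => 0
  | .cancelLeave _ => 0
  | .finishEra _ _ _ => 0
  | .finishTag _ _ => 0
  | .finishLeave _ => 0
  | _ => n

/-- A bound on the steps to come, not counting those of repeated iterations. -/
def GPLine.distance (m : ℕ) : GPLine Blk → ℕ
  | .start => 23 + 3 * m
  | .fastDeref k _ => 22 + 3 * k
  | .fastCheck k _ _ => 21 + 3 * k
  | .fastPublish k _ => 20 + 3 * k
  | .parentEra _ => 19
  | .enter _ _ => 18
  | .setPointer _ _ => 17
  | .setEra _ _ => 16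
  | .readTag _ => 15
  | .request _ _ => 14
  -- Going back here from `loopTest` raises the distance by 5. The account weights each repetition
  -- by 10, which covers this increase and the step itself.
  | .loopDeref _ _ => 10
  | .loopCheck _ _ _ => 9
  | .cancel _ _ _ _ => 8
  | .cancelTag _ _ => 2
  | .cancelLeave _ => 1
  | .loopPublish _ _ _ => 7
  | .loopResPtr _ _ => 6
  | .loopTest _ _ _ => 5
  | .finishEra _ _ _ => 3
  | .finishTag _ _ => 2
  | .finishLeave _ => 1

/-- A bound on the iterations of the fast path still to begin. -/
def GPLine.attempts (m : ℕ) : GPLine Blk → ℕ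
  | .start => m
  -- The loop body runs before its counter is tested, so even a counter 0 must pay for one
  -- iteration; this avoids an invariant `0 < k`.
  | .fastDeref k _ => max k 1
  | .fastCheck k _ _ => k - 1
  | .fastPublish k _ => k - 1
  | _ => 0

/-- The line at which an iteration of the fast path begins. -/
def GPLine.IsAttempt : GPLine Blk → Prop
  | .fastDeref _ _ => True
  | _ => False

/-- The line at which an unsuccessful iteration of the slow-path loop ends. -/
def GPLine.IsRepeat : GPLine Blk → Prop
  | .loopTest _ _ .invptr => True
  | _ => False

/-- `GPLine.repeats` for a thread that runs `get_protected(a)`. -/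
noncomputable def Config.repeats (c : Config P Blk Loc) (t : Fin P.n) (a : Args P Blk Loc)
    (l : GPLine Blk) : ℕ :=
  l.repeats P.n ((c.result t a.index).1 = .invptr) (c.slack t a.index)

omit [DecidableEq Blk] in
theorem GPLine.repeats_mono (n : ℕ) {pending pending' : Prop} {slack slack' : ℕ → ℕ∞ → ℕ}
    (l : GPLine Blk) (hp : pending' → pending)
    (hs : pending' → ∀ tag, l.awaited = some tag → ∀ e, slack' tag e ≤ slack tag e) :
    l.repeats n pending' slack' ≤ l.repeats n pending slack := by
  cases l <;> simp only [GPLine.repeats, GPLine.awaited, le_refl] at hs ⊢ <;> grind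

/-- Another thread cannot make the request pending, and while it stays pending `slack` does not
grow. -/
theorem Step.repeats_le_of_ne (h : Step p c c') (hi : Inv c) (hp : t ≠ p) {a : Args P Blk Loc}
    {l : GPLine Blk} (ht : c.pc t = .getProtected a l) :
    c'.repeats t a l ≤ c.repeats t a l := by
  refine GPLine.repeats_mono _ _ (h.pending_of_ne hi hp) fun hres' tag hl e => ?_
  obtain ⟨g, h1, -, h3⟩ := hi.pending _ _ (h.pending_of_ne hi hp hres')
  rw [ht] at h3
  obtain rfl : tag = g := by simpa [hl] using h3.2
  exact h.slack_le hi ht h1 hres' e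

open Classical in
-- An own step leaves the era alone, so the potential changes only through the line reached and
-- `prevEra`. Replacing an outdated `prevEra` by the era just read lowers `slack` by 1, and this 1
-- pays for the iteration if it fails.
theorem Step.own (h : Step t c c') (hi : Inv c) {a a' : Args P Blk Loc} {l l' : GPLine Blk}
    (ht : c.pc t = .getProtected a l) (ht' : c'.pc t = .getProtected a' l') :
    a' = a ∧ c'.repeats t a l' + (if l.IsRepeat then 1 else 0) ≤ c.repeats t a l ∧
      l'.distance P.maxAttempts + 10 * c'.repeats t a l' + 1 ≤
        l.distance P.maxAttempts + 10 * c.repeats t a l ∧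
      l'.attempts P.maxAttempts + (if l.IsAttempt then 1 else 0) ≤ l.attempts P.maxAttempts := by
  -- Needed when the fast path is entered, where `max P.maxAttempts 1` must not exceed
  -- `P.maxAttempts`.
  have hM := P.maxAttempts_pos
  have heq := h.of_getProtected ht
  have hera : c'.shared.globalEra = c.shared.globalEra := by
    rw [heq]; exact (gpStep_counters ..).1
  have hserves : ∀ g, (c'.pc t).Serves t a.index g :=
    PC.Serves.of_getProtected (by simp [ht', PC.isGetProtected]) t a.index
  have hbump : ∀ g, c'.bumpers t a.index g ≤ c.bumpers t a.index g :=
    fun g => h.bumpers_le fun _ => hserves g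
  have hbumplt : ∀ g, c'.bumpers t a.index g < P.n :=
    fun g => Config.bumpers_lt (by simp [ht', PC.isGetProtected])
  have hslack : ∀ g e, c'.slack t a.index g e ≤ c.slack t a.index g e := by
    intro g e
    unfold Config.slack
    rw [hera]
    have := hbump g
    omega
  -- Used at the publication of the request, where the initial bound `n` is replaced by `slack`.
  have hslackn : ∀ g e, c'.slack t a.index g e ≤ P.n := by
    intro g e
    unfold Config.slack
    have := hbumplt g
    split_ifs <;> omega
  have hera0 : ∀ g, c.slack t a.index g c.shared.globalEra = c.bumpers t a.index g := by
    simp [Config.slack]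
  have hera1 : ∀ g e, e ≠ (c.shared.globalEra : ℕ∞) →
      c.slack t a.index g e = c.bumpers t a.index g + 1 := by
    intro g e he
    simp [Config.slack, he]
  -- A pending request carries the very tag that the owner holds, so the cancelling WCAS cannot fail
  -- on a tag mismatch.
  have hpend : (c.result t a.index).1 = .invptr → ∀ g, l.awaited = some g →
      c.result t a.index = (.invptr, (g : ℕ∞)) := by
    intro h1 g hg
    obtain ⟨g', h2, -, h3⟩ := hi.pending _ _ h1
    rw [ht] at h3
    obtain rfl : g = g' := by simpa [hg] using h3.2
    exact h2
  unfold Config.repeats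
  generalize c'.slack t a.index = s' at *
  generalize hs : c.slack t a.index = s at *
  have hres : c'.result t a.index =
      ((gpStep t a l c.shared (c.thread t)).1.state t a.index).result := by rw [heq]; rfl
  have hpc : (gpStep t a l c.shared (c.thread t)).2.pc = .getProtected a' l' := by
    rw [← ht', heq, Config.set_pc_self]
  rw [hres]
  unfold Config.result at hpend ⊢
  clear heq hres ht ht' h
  cases hptr : (c.shared.state t a.index).result.1 <;> cases l <;>
    simp only [gpStep, Local.goto, Local.done] at hpc ⊢ <;> (try split at hpc) <;> first
    | contradiction
    | (obtain ⟨rfl, rfl⟩ := PC.getProtected.inj hpc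
       simp_all [GPLine.repeats, GPLine.distance, GPLine.attempts, GPLine.IsRepeat,
         GPLine.IsAttempt, GPLine.awaited, Shared.setResult_result, apply_ite Shared.state]
       try grind)

/-! ### Summation along an execution -/

theorem card_filter_Ioo_succ {s u : ℕ} (hu : s < u) (Q : ℕ → Prop) [DecidablePred Q] :
    ((Finset.Ioo s (u + 1)).filter Q).card =
      ((Finset.Ioo s u).filter Q).card + if Q u then 1 else 0 := by
  have : Finset.Ioo s (u + 1) = insert u (Finset.Ioo s u) := by ext k; simp; omega
  rw [this, Finset.filter_insert]
  split_ifs <;> simp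

namespace Execution

variable (e : Execution P Blk Loc)

/-- The steps and iterations made so far, together with the bounds on those to come, never exceed
the bounds at the invocation. -/
theorem account {a : Args P Blk Loc} {s u : ℕ} (hinv : e.Invokes t a s) (hu : e.Pending t s u) :
    ∃ l, (e.cfg u).pc t = .getProtected a l ∧
      e.fastAttempts t s u + l.attempts P.maxAttempts ≤ P.maxAttempts ∧
      e.slowRepeats t s u + (e.cfg u).repeats t a l ≤ P.n ∧
      e.ownSteps t s u + (l.distance P.maxAttempts + 10 * (e.cfg u).repeats t a l) ≤
        23 + 3 * P.maxAttempts + 10 * P.n := by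
  obtain ⟨hsu, hlen, hpend⟩ := hu
  induction u, hsu using Nat.le_induction with
  | base =>
    refine ⟨.start, hinv.2.2.2, ?_⟩
    have : Finset.Ioo s (s + 1) = ∅ := by ext k; simp
    simp [fastAttempts, slowRepeats, ownSteps, this, GPLine.attempts, GPLine.distance,
      Config.repeats, GPLine.repeats]
  | succ u hsu ih =>
    obtain ⟨l, hl, h1, h2, h3⟩ := ih (by omega) fun k hk hk' => hpend k hk (by omega)
    have hst := e.step u (by omega)
    have hi := e.inv (k := u) (by omega)
    simp only [fastAttempts, slowRepeats, ownSteps, card_filter_Ioo_succ hsu] at h1 h2 h3 ⊢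
    by_cases hw : e.who u = t
    · rw [hw] at hst
      obtain ⟨a', l', hl'⟩ := hpend (u + 1) (by omega) le_rfl
      obtain ⟨rfl, h4, h5, h6⟩ := hst.own hi hl hl'
      refine ⟨l', hl', ?_, ?_, ?_⟩
      · have : (e.who u = t ∧ ∃ a attempts prevEra,
            e.pc t u = .getProtected a (.fastDeref attempts prevEra)) → l.IsAttempt := by
          rintro ⟨-, b, k, x, h⟩
          rw [pc, ← Config.pc, hl] at h
          obtain ⟨-, rfl⟩ := PC.getProtected.inj h
          trivial
        split_ifs at h6 ⊢ <;> first
          | omega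
          | exact absurd (this (by assumption)) (by assumption)
      · have : (e.who u = t ∧ ∃ a tag prevEra,
            e.pc t u = .getProtected a (.loopTest tag prevEra .invptr)) → l.IsRepeat := by
          rintro ⟨-, b, k, x, h⟩
          rw [pc, ← Config.pc, hl] at h
          obtain ⟨-, rfl⟩ := PC.getProtected.inj h
          trivial
        split_ifs at h4 ⊢ <;> first
          | omega
          | exact absurd (this (by assumption)) (by assumption)
      · rw [if_pos hw]
        omega
    -- A step of another thread adds nothing to the three counts and keeps the line of `t`, so only
    -- `repeats` could change.
    · have := hst.repeats_le_of_ne hi (Ne.symm hw) hl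
      refine ⟨l, by rw [hst.pc_of_ne (Ne.symm hw)]; exact hl, ?_, ?_, ?_⟩ <;>
        simp only [hw, false_and, if_false] <;> omega

/-- A call that is not pending any more has returned. -/
theorem returns_of_not_pending {a : Args P Blk Loc} {s u : ℕ} (hinv : e.Invokes t a s)
    (hsu : s < u) (hu : u ≤ e.length) (h : ¬ e.Pending t s u) : ∃ r < u, e.Returns t s r := by
  induction u, hsu using Nat.le_induction with
  | base =>
    refine absurd ⟨by omega, hu, fun k hk hk' => ?_⟩ h
    obtain rfl : k = s + 1 := by omega
    exact ⟨a, _, hinv.2.2.2⟩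
  | succ u hsu ih =>
    by_cases hp : e.Pending t s u
    · refine ⟨u, by omega, hp, by omega, ?_⟩
      obtain ⟨b, l, hl⟩ := hp.2.2 u hsu le_rfl
      have hst := e.step u (by omega)
      have hnot : ¬ ∃ a l, e.pc t (u + 1) = .getProtected a l := by
        refine fun hx => h ⟨by omega, hu, fun k hk hk' => ?_⟩
        rcases hk'.lt_or_eq with h' | rfl
        · exact hp.2.2 k hk (by omega)
        · exact hx
      -- No other thread can move the program counter of `t`, so the step that ends the call is made
      -- by `t`.
      have hw : e.who u = t := by
        by_contra hw
        exact hnot ⟨b, l, (hst.pc_of_ne (Ne.symm hw)).trans hl⟩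
      refine ⟨hw, ?_⟩
      rw [hw] at hst
      have heq : e.pc t (u + 1) = (gpStep t b l (e.cfg u).shared ((e.cfg u).thread t)).2.pc := by
        rw [pc, hst.of_getProtected hl]
        exact Config.set_pc_self ..
      rw [heq] at hnot ⊢
      exact (gpStep_pc ..).resolve_right fun ⟨l', h'⟩ => hnot ⟨b, l', h'⟩
    · obtain ⟨r, hr, hr'⟩ := ih (by omega) hp
      exact ⟨r, by omega, hr'⟩

end Execution

end WFE

/-! ### The theorem -/

theorem mainTheorem1 :
    ∃ C : ℕ, ∀ (P : WFE.Params) (Blk Loc : Type) [DecidableEq Blk]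
      (e : WFE.Execution P Blk Loc) (t : Fin P.n) (a : WFE.Args P Blk Loc) (s : ℕ),
      e.Invokes t a s →
        -- the call never blocks, and its loops and its own steps are bounded
        (∀ u, e.Pending t s u →
          (∃ c', WFE.Step t (e.cfg u) c') ∧
          e.fastAttempts t s u ≤ P.maxAttempts ∧
          e.slowRepeats t s u ≤ P.n ∧
          e.ownSteps t s u ≤ C * (P.maxAttempts + P.n)) ∧
        -- the call returns as soon as its thread has made enough steps
        (∀ u ≤ e.length, C * (P.maxAttempts + P.n) < e.ownSteps t s u →
          ∃ r, r < u ∧ e.Returns t s r) := by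
  -- The account gives `23 + 3 * M + 10 * n`, and `1 ≤ M` absorbs the constant term; 33 is not
  -- optimal.
  refine ⟨33, fun P Blk Loc _ e t a s hinv => ?_⟩
  have hn : 0 < P.n := t.pos
  have hM := P.maxAttempts_pos
  have hsteps : ∀ u, e.Pending t s u → e.ownSteps t s u ≤ 33 * (P.maxAttempts + P.n) := by
    intro u hu
    obtain ⟨l, -, -, -, h⟩ := e.account hinv hu
    omega
  refine ⟨fun u hu => ⟨?_, ?_, ?_, hsteps u hu⟩, fun u hu hlt => ?_⟩
  · obtain ⟨b, l, hl⟩ := hu.2.2 u hu.1 le_rfl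
    -- `gpStep` is a total function: no line of `get_protected()` waits for a condition.
    exact ⟨_, .getProtected b l hl⟩
  · obtain ⟨l, -, h, -⟩ := e.account hinv hu
    omega
  · obtain ⟨l, -, -, h, -⟩ := e.account hinv hu
    omega
  · refine e.returns_of_not_pending hinv ?_ hu fun hp => absurd (hsteps u hp) (by omega)
    -- For `u ≤ s` no steps are counted, which contradicts the strict lower bound `hlt`.
    by_contra hsu
    have : Finset.Ioo s u = ∅ := Finset.Ioo_eq_empty (by omega)
    simp [WFE.Execution.ownSteps, this] at hlt
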